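/- **Setting.** Let $f:\mathbb R^n\to\mathbb R$ be convex and continuously differentiable with $f(y)\le f(x)+\langle\nabla f(x),y-x\rangle+\frac L2\|x-y\|_2^2$ for all $x,y$, let $x^*$ be a minimizer of $f$, let $x^0\in\mathbb R^n$ and $R=\|x^0-x^*\|_2$. Exact values of $f$ are available; gradients are available through a stochastic oracle $\nabla f(x,\xi)$ with $$\mathbb E\,\nabla f(x,\xi)=\nabla f(x),\qquad \mathbb E\exp\!\big(\|\nabla f(x,\xi)-\nabla f(x)\|_2^2/\sigma^2\big)\le \exp(1)\qquad\text{for all }x,$$ where $0<\sigma\le\sigma_0$. Let $0<\underline L\le L\le\bar L$, where $\bar L=2^m\underline L$ with an integer $m\ge1$, let $L_0=2^{j_0}\underline L$ with an integer $0\le j_0\le m$, and let $\varepsilon>0$, $\alpha\in(0,1)$, $N\ge2$ and $b>0$. Put $\ell=\ln\alpha^{-1}+m\ln N$. **Method.** Set $A_0=0$, $u^0=x^0$. For $k=0,\dots,N-1$: set $L_{k+1}:=\max\{L_k/2,\underline L\}$, and repeat the following pass until the test below holds. Set $L_{k+1}:=\min\{2L_{k+1},\bar L\}$; compute $$\alpha_{k+1}=\frac{1+\sqrt{1+8A_kL_{k+1}}}{4L_{k+1}},\quad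 A_{k+1}=A_k+\alpha_{k+1},\quad r_{k+1}=\max\Big\{\Big\lceil b\,\frac{\alpha_{k+1}\sigma_0^2\bar L^2}{\varepsilon\underline L^2}\,\ell\Big\rceil,1\Big\},$$ $$y^{k+1}=\frac{\alpha_{k+1}u^k+A_kx^k}{A_{k+1}},\quad g^{k+1}=\frac1{r_{k+1}}\sum_{l=1}^{r_{k+1}}\nabla f(y^{k+1},\xi^{k+1}_l),\quad u^{k+1}=u^k-\alpha_{k+1}g^{k+1},\quad x^{k+1}=\frac{\alpha_{k+1}u^{k+1}+A_kx^k}{A_{k+1}};$$ the test is $$f(x^{k+1})\le f(y^{k+1})+\langle g^{k+1},x^{k+1}-y^{k+1}\rangle+L_{k+1}\|x^{k+1}-y^{k+1}\|_2^2+\frac{\alpha_{k+1}}{2A_{k+1}}\varepsilon .$$ The output is $x^N$. The samples $\xi^{k+1}_l$ may be reused in the passes of one iteration or drawn anew; it is only required that, for every choice fixed in advance of one pass in each iteration, the samples of the chosen passes are i.i.d. copies of $\xi$. Let $T$ be the number of stochastic gradients computed, those of the rejected passes included. **Theorem.** There is an absolute constant $c_1>0$ such that for every $c_2\ge c_1$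 there is $b_0>0$ such that for every $b\ge b_0$ there is $C>0$ (so $C$ depends on $c_2$ and $b$ only) with the following property. In the setting above, if $$c_1\sqrt{\bar LR^2/\varepsilon}\;\le\; N\;\le\; c_2\sqrt{\bar LR^2/\varepsilon},$$ then with probability at least $1-\alpha$ all the line searches of the method stop, its output satisfies $f(x^N)-f(x^*)\le\varepsilon$, and $$T\;\le\; C\,\frac{\sigma_0^2R^2\bar L^3}{\varepsilon^2\underline L^3}\,\big(\ln\alpha^{-1}+m\ln N\big)+N+m .$$ -/

import Mathlib

open MeasureTheory ProbabilityTheory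
open scoped Gradient InnerProductSpace

noncomputable section

namespace AccStoch

/-- Euclidean space `ℝⁿ`. -/
abbrev Vec (n : ℕ) : Type := EuclideanSpace ℝ (Fin n)

/-- `f` is continuously differentiable and satisfies the quadratic upper bound with constant `L`. -/
def HasLipschitzGradient {n : ℕ} (f : Vec n → ℝ) (L : ℝ) : Prop :=
  ContDiff ℝ 1 f ∧
    ∀ x y : Vec n, f y ≤ f x + ⟪∇ f x, y - x⟫_ℝ + L / 2 * ‖x - y‖ ^ 2

/-- `G x z` is a stochastic gradient of `f` at `x` (with `z` of law `ν`): it is unbiased and its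
noise is light-tailed, `𝔼 exp (‖G x z - ∇ f x‖² / σ²) ≤ exp 1`.  (The expectation in `light_tail`
is a Lebesgue integral with values in `[0, ∞]`, so finiteness is part of the bound.) -/
structure IsSubGaussianOracle {n : ℕ} {Ξ : Type*} [MeasurableSpace Ξ]
    (f : Vec n → ℝ) (G : Vec n → Ξ → Vec n) (ν : Measure Ξ) (σ : ℝ) : Prop where
  measurable : Measurable (Function.uncurry G)
  integrable : ∀ x, Integrable (G x) ν
  unbiased : ∀ x, ∫ z, G x z ∂ν = ∇ f x
  light_tail : ∀ x, ∫⁻ z, ENNReal.ofReal (Real.exp (‖G x z - ∇ f x‖ ^ 2 / σ ^ 2)) ∂ν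
    ≤ ENNReal.ofReal (Real.exp 1)

/-- Mini-batch stochastic gradient `∇ʳ f(x, {ξ_l})`, the mean of `r` oracle answers. -/
def miniBatch {n : ℕ} {Ξ : Type*} (G : Vec n → Ξ → Vec n) (r : ℕ) (z : ℕ → Ξ) (x : Vec n) :
    Vec n :=
  (r : ℝ)⁻¹ • ∑ l ∈ Finset.range r, G x (z l)

/-- Input of the method: the bounds `Llow`, `Lbar` used for clipping, the initial guess `L₀`, the
accuracy `ε`, the noise bound `σ₀`, the confidence parameter `α`, the constant `b` in the batch
size, the integer `m = log₂ (Lbar / Llow)`, and the number `N` of iterations. -/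
structure Params where
  Llow : ℝ
  Lbar : ℝ
  L₀ : ℝ
  ε : ℝ
  σ₀ : ℝ
  α : ℝ
  b : ℝ
  m : ℕ
  N : ℕ

/-- The logarithmic factor `ln α⁻¹ + m ln N`. -/
def Params.logFactor (p : Params) : ℝ := Real.log p.α⁻¹ + p.m * Real.log p.N

/-- Batch size for a step with weight `a`. -/
def Params.batchSize (p : Params) (a : ℝ) : ℕ :=
  max ⌈p.b * (a * p.σ₀ ^ 2 * p.Lbar ^ 2 / (p.ε * p.Llow ^ 2) * p.logFactor)⌉₊ 1

/-- The weight `a = α_{k+1}`, the positive root of `A + a = 2 L a²`, for `A = A_k`,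
`L = L_{k+1}`. -/
def stepWeight (A L : ℝ) : ℝ := (1 + √(1 + 8 * A * L)) / (4 * L)

/-- The constant tried in the `j`-th pass (`j = 0, 1, …`) of the line search of an iteration that
starts from `L`: first `max (L / 2) Llow`, then `min (2 · ) Lbar` at the start of every pass. -/
def Params.trialL (p : Params) (L : ℝ) : ℕ → ℝ
  | 0 => min (2 * max (L / 2) p.Llow) p.Lbar
  | j + 1 => min (2 * p.trialL L j) p.Lbar

/-- State after `k` iterations: `A_k`, `L_k`, `x^k`, `u^k`, and the number of stochastic gradients
requested so far (in all passes of all line searches). -/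
structure State (n : ℕ) where
  A : ℝ
  L : ℝ
  x : Vec n
  u : Vec n
  calls : ℕ

section Algorithm

variable {n : ℕ} {Ξ : Type*} (f : Vec n → ℝ) (G : Vec n → Ξ → Vec n) (p : Params)

/-- `y^{k+1}` in a pass with constant `L`. -/
def trialY (s : State n) (L : ℝ) : Vec n :=
  (s.A + stepWeight s.A L)⁻¹ • (stepWeight s.A L • s.u + s.A • s.x)

/-- The batch size in a pass with constant `L`. -/
def trialBatch (s : State n) (L : ℝ) : ℕ := p.batchSize (stepWeight s.A L)

/-- The mini-batch gradient at `y^{k+1}` in a pass with constant `L` and samples `z`. -/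
def trialGrad (s : State n) (L : ℝ) (z : ℕ → Ξ) : Vec n :=
  miniBatch G (trialBatch p s L) z (trialY s L)

/-- `u^{k+1}` in a pass with constant `L` and samples `z`. -/
def trialU (s : State n) (L : ℝ) (z : ℕ → Ξ) : Vec n :=
  s.u - stepWeight s.A L • trialGrad G p s L z

/-- `x^{k+1}` in a pass with constant `L` and samples `z`. -/
def trialX (s : State n) (L : ℝ) (z : ℕ → Ξ) : Vec n :=
  (s.A + stepWeight s.A L)⁻¹ • (stepWeight s.A L • trialU G p s L z + s.A • s.x)

/-- The stopping test of the line search. -/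
def Accept (s : State n) (L : ℝ) (z : ℕ → Ξ) : Prop :=
  f (trialX G p s L z) ≤
    f (trialY s L) + ⟪trialGrad G p s L z, trialX G p s L z - trialY s L⟫_ℝ
      + L * ‖trialX G p s L z - trialY s L‖ ^ 2
      + stepWeight s.A L / (2 * (s.A + stepWeight s.A L)) * p.ε

open Classical in
/-- One iteration.  `z j l` is the `l`-th sample of the `j`-th pass of the line search.  The first
accepted pass is kept; the result is `none` if the line search never stops. -/
def iterate (s : State n) (z : ℕ → ℕ → Ξ) : Option (State n) :=
  if h : ∃ j, Accept f G p s (p.trialL s.L j) (z j) then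
    some
      { A := s.A + stepWeight s.A (p.trialL s.L (Nat.find h))
        L := p.trialL s.L (Nat.find h)
        x := trialX G p s (p.trialL s.L (Nat.find h)) (z (Nat.find h))
        u := trialU G p s (p.trialL s.L (Nat.find h)) (z (Nat.find h))
        calls := s.calls +
          ∑ i ∈ Finset.range (Nat.find h + 1), trialBatch p s (p.trialL s.L i) }
  else none

/-- The first `k` iterations from the starting point `x₀`, where `z i j l` is the `l`-th sample in
the `j`-th pass of the line search of the `i`-th iteration (all counted from `0`); `none` if one of
the line searches never stops. -/
def run (x₀ : Vec n) (z : ℕ → ℕ → ℕ → Ξ) : ℕ → Option (State n)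
  | 0 => some { A := 0, L := p.L₀, x := x₀, u := x₀, calls := 0 }
  | k + 1 => (run x₀ z k).bind fun s => iterate f G p s (z k)

end Algorithm

end AccStoch

end

/-! The potential `A_k (f(x^k) - f(x*)) + ‖u^k - x*‖² / 2` grows in an accepted step by at most
`α_{k+1} ⟨δ, x* - u^k⟩ + α_{k+1} ε / 2`, where `δ` is the error of the mini-batch gradient
(`potential_step_le`). If the noise terms sum to at most `R²`, then `A_N (f(x^N) - f(x*)) ≤ 3R²/2 +
A_N ε / 2`. Since `A_N ≥ N² / (8 L̄)`, a large enough `N / √(L̄R²/ε)` gives accuracy `ε`.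

The obstacle is that the test looks at the same samples as the step. The samples of the accepted
pass are therefore selected, and their errors need not be centred. The remedy is to fix in advance
which pass is kept in each iteration (`forcedRun`). Along such a run the samples are i.i.d., and the
constants, weights and batch sizes are deterministic. The errors are then martingale differences
with sub-Gaussian tails (`measure_norm_forcedNoise_le`, `measure_noiseSum_le`).

Few forced runs matter. The halving at the start of an iteration is cancelled by the doubling of its
first pass, so the constant never decreases, and each rejection doubles it. At `L̄` the test holds
as soon as the noise is small (`accept_of_norm_trialNoise_le`). Hence at most `m` passes are
rejected in the whole run, and `(N + 1) ^ m` forced runs cover all possibilities. The term `m ln N`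
in the batch size pays for the union bound over them. Outside the bad events the method follows one
of these runs (`exists_run_eq_forcedRun`).

To have bounded increments in the martingale, `x* - u^k` is clipped at a radius `D`. The potential
bound shows inductively that the clipping is never active outside the bad events (`potential_le`).

For the cost, batch sizes are proportional to weights up to rounding. The accepted weights sum to
`A_N ≤ N² / (2 L̲)`. The rejected passes have distinct exponents `e`, with weights at most `(N / L̲)
(3/4)^e`, so their sum is geometric. Rounding costs one sample per pass, hence the term `N + m`. -/

set_option linter.unusedSectionVars false

noncomputable section

namespace AccStoch

/-! ### Exponential moments of one light-tailed vector. -/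

section SubGaussian

theorem exp_le_add_exp_sq (x : ℝ) : Real.exp x ≤ x + Real.exp (x ^ 2) := by
  have h2 : x ^ 2 + 1 ≤ Real.exp (x ^ 2) := Real.add_one_le_exp _
  rcases le_or_gt |x| 1 with h | h
  · have := (abs_le.1 (Real.abs_exp_sub_one_sub_id_le h)).2
    linarith
  · rcases lt_abs.1 h with h | h
    · have : Real.exp x ≤ Real.exp (x ^ 2) := Real.exp_le_exp.2 (by nlinarith)
      linarith
    · have : Real.exp x ≤ 1 := Real.exp_le_one_iff.2 (by linarith)
      nlinarith

variable {E : Type*} [NormedAddCommGroup E] [InnerProductSpace ℝ E] [MeasurableSpace E]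
  [BorelSpace E] [SecondCountableTopology E] [CompleteSpace E]
  {Ω : Type*} [MeasurableSpace Ω] {P : Measure Ω} [IsProbabilityMeasure P]
  {X : Ω → E} {σ : ℝ}

/-- Jensen for the concave power `cσ² ≤ 1`, in the form of Hölder's inequality against the constant
`1`. -/
theorem lintegral_exp_mul_norm_sq_le (hX : Measurable X)
    (h : ∫⁻ ω, ENNReal.ofReal (Real.exp (‖X ω‖ ^ 2 / σ ^ 2)) ∂P ≤ ENNReal.ofReal (Real.exp 1))
    (hσ : 0 < σ) {c : ℝ} (hc : 0 ≤ c) (hcσ : c * σ ^ 2 ≤ 1) :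
    ∫⁻ ω, ENNReal.ofReal (Real.exp (c * ‖X ω‖ ^ 2)) ∂P
      ≤ ENNReal.ofReal (Real.exp (c * σ ^ 2)) := by
  have hp : 0 ≤ c * σ ^ 2 := by positivity
  have := ENNReal.lintegral_mul_norm_pow_le (μ := P)
    (f := fun ω => ENNReal.ofReal (Real.exp (‖X ω‖ ^ 2 / σ ^ 2))) (g := fun _ => 1)
    (by fun_prop) (by fun_prop) hp (sub_nonneg.2 hcσ) (by ring)
  simp only [ENNReal.one_rpow, mul_one, lintegral_const, measure_univ] at this
  calc _ = ∫⁻ ω, ENNReal.ofReal (Real.exp (‖X ω‖ ^ 2 / σ ^ 2)) ^ (c * σ ^ 2) ∂P := by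
        refine lintegral_congr fun ω => ?_
        rw [ENNReal.ofReal_rpow_of_pos (Real.exp_pos _), ← Real.exp_mul]
        congr 2
        field_simp
    _ ≤ _ := this
    _ ≤ ENNReal.ofReal (Real.exp 1) ^ (c * σ ^ 2) := by gcongr
    _ = _ := by
        rw [ENNReal.ofReal_rpow_of_pos (Real.exp_pos _), ← Real.exp_mul, one_mul]

/-- For `‖w‖σ ≤ 1`, the linear term of `exp_le_add_exp_sq` integrates to zero and the square is
within reach of the light tail. For `‖w‖σ > 1`, Young's inequality suffices without centring, and
the resulting factor `e` is absorbed by `exp (‖w‖²σ²)`. -/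
theorem lintegral_exp_inner_le (hX : Measurable X) (hi : Integrable X P) (h0 : ∫ ω, X ω ∂P = 0)
    (h : ∫⁻ ω, ENNReal.ofReal (Real.exp (‖X ω‖ ^ 2 / σ ^ 2)) ∂P ≤ ENNReal.ofReal (Real.exp 1))
    (hσ : 0 < σ) (w : E) :
    ∫⁻ ω, ENNReal.ofReal (Real.exp ⟪w, X ω⟫_ℝ) ∂P
      ≤ ENNReal.ofReal (Real.exp (2 * ‖w‖ ^ 2 * σ ^ 2)) := by
  have hb : ∀ ω, ⟪w, X ω⟫_ℝ ≤ ‖w‖ * ‖X ω‖ := fun ω => real_inner_le_norm _ _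
  rcases le_or_gt (‖w‖ ^ 2 * σ ^ 2) 1 with hw | hw
  · have hE := lintegral_exp_mul_norm_sq_le hX h hσ (sq_nonneg ‖w‖) hw
    have hint : Integrable (fun ω => Real.exp (‖w‖ ^ 2 * ‖X ω‖ ^ 2)) P := by
      refine ⟨by fun_prop, ?_⟩
      rw [hasFiniteIntegral_iff_ofReal (Filter.Eventually.of_forall fun _ => (Real.exp_pos _).le)]
      exact hE.trans_lt ENNReal.ofReal_lt_top
    have hin : Integrable (fun ω => ⟪w, X ω⟫_ℝ) P := hi.const_inner w
    have hz : ∫ ω, ⟪w, X ω⟫_ℝ ∂P = 0 := by rw [integral_inner hi, h0, inner_zero_right]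
    have hle : ∀ ω, Real.exp ⟪w, X ω⟫_ℝ ≤ ⟪w, X ω⟫_ℝ + Real.exp (‖w‖ ^ 2 * ‖X ω‖ ^ 2) := by
      intro ω
      refine (exp_le_add_exp_sq _).trans ?_
      gcongr
      rw [← mul_pow, ← sq_abs]
      gcongr
      exact abs_real_inner_le_norm _ _
    calc _ ≤ ∫⁻ ω, ENNReal.ofReal (⟪w, X ω⟫_ℝ + Real.exp (‖w‖ ^ 2 * ‖X ω‖ ^ 2)) ∂P :=
          lintegral_mono fun ω => ENNReal.ofReal_le_ofReal (hle ω)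
      _ = ENNReal.ofReal (∫ ω, ⟪w, X ω⟫_ℝ + Real.exp (‖w‖ ^ 2 * ‖X ω‖ ^ 2) ∂P) := by
          refine (ofReal_integral_eq_lintegral_ofReal (hin.add hint) ?_).symm
          exact Filter.Eventually.of_forall fun ω => (Real.exp_pos _).le.trans (hle ω)
      _ = ENNReal.ofReal (∫ ω, Real.exp (‖w‖ ^ 2 * ‖X ω‖ ^ 2) ∂P) := by
          rw [integral_add hin hint, hz, zero_add]
      _ = ∫⁻ ω, ENNReal.ofReal (Real.exp (‖w‖ ^ 2 * ‖X ω‖ ^ 2)) ∂P :=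
          ofReal_integral_eq_lintegral_ofReal hint
            (Filter.Eventually.of_forall fun _ => (Real.exp_pos _).le)
      _ ≤ _ := hE.trans (ENNReal.ofReal_le_ofReal (Real.exp_le_exp.2 (by nlinarith [sq_nonneg (‖w‖ * σ)])))
  · calc _ ≤ ∫⁻ ω, ENNReal.ofReal (Real.exp (‖w‖ ^ 2 * σ ^ 2))
            * ENNReal.ofReal (Real.exp (‖X ω‖ ^ 2 / σ ^ 2)) ∂P := by
          refine lintegral_mono fun ω => ?_
          rw [← ENNReal.ofReal_mul (Real.exp_pos _).le, ← Real.exp_add]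
          refine ENNReal.ofReal_le_ofReal (Real.exp_le_exp.2 ((hb ω).trans ?_))
          have : ‖w‖ * ‖X ω‖ = (‖w‖ * σ) * (‖X ω‖ / σ) := by field_simp
          rw [this, ← mul_pow, ← div_pow]
          nlinarith [sq_nonneg (‖w‖ * σ - ‖X ω‖ / σ), sq_nonneg (‖w‖ * σ), sq_nonneg (‖X ω‖ / σ)]
      _ = ENNReal.ofReal (Real.exp (‖w‖ ^ 2 * σ ^ 2))
            * ∫⁻ ω, ENNReal.ofReal (Real.exp (‖X ω‖ ^ 2 / σ ^ 2)) ∂P :=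
          lintegral_const_mul _ (by fun_prop)
      _ ≤ ENNReal.ofReal (Real.exp (‖w‖ ^ 2 * σ ^ 2)) * ENNReal.ofReal (Real.exp 1) := by gcongr
      _ ≤ _ := by
          rw [← ENNReal.ofReal_mul (Real.exp_pos _).le, ← Real.exp_add]
          exact ENNReal.ofReal_le_ofReal (Real.exp_le_exp.2 (by linarith))

/-- Cauchy–Schwarz separates the two terms at the price of doubling `w` and `c`, whence the constant
`4` and the condition on `2 * c`. -/
theorem lintegral_exp_inner_add_le (hX : Measurable X) (hi : Integrable X P)
    (h0 : ∫ ω, X ω ∂P = 0)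
    (h : ∫⁻ ω, ENNReal.ofReal (Real.exp (‖X ω‖ ^ 2 / σ ^ 2)) ∂P ≤ ENNReal.ofReal (Real.exp 1))
    (hσ : 0 < σ) (w : E) {c : ℝ} (hc : 0 ≤ c) (hcσ : 2 * c * σ ^ 2 ≤ 1) :
    ∫⁻ ω, ENNReal.ofReal (Real.exp (⟪w, X ω⟫_ℝ + c * ‖X ω‖ ^ 2)) ∂P
      ≤ ENNReal.ofReal (Real.exp (4 * ‖w‖ ^ 2 * σ ^ 2 + c * σ ^ 2)) := by
  have h1 := lintegral_exp_inner_le hX hi h0 h hσ ((2 : ℝ) • w)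
  have h2 := lintegral_exp_mul_norm_sq_le hX h hσ (c := 2 * c) (by positivity) hcσ
  have := ENNReal.lintegral_mul_norm_pow_le (μ := P)
    (f := fun ω => ENNReal.ofReal (Real.exp ⟪(2 : ℝ) • w, X ω⟫_ℝ))
    (g := fun ω => ENNReal.ofReal (Real.exp (2 * c * ‖X ω‖ ^ 2)))
    (by fun_prop) (by fun_prop) (p := 1 / 2) (q := 1 / 2) (by norm_num) (by norm_num) (by norm_num)
  calc _ = _ := by
        refine lintegral_congr fun ω => ?_
        rw [ENNReal.ofReal_rpow_of_pos (Real.exp_pos _), ENNReal.ofReal_rpow_of_pos (Real.exp_pos _),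
          ← Real.exp_mul, ← Real.exp_mul, ← ENNReal.ofReal_mul (Real.exp_pos _).le, ← Real.exp_add,
          real_inner_smul_left]
        congr 2
        ring
    _ ≤ _ := this
    _ ≤ ENNReal.ofReal (Real.exp (2 * ‖(2 : ℝ) • w‖ ^ 2 * σ ^ 2)) ^ (1 / 2 : ℝ)
        * ENNReal.ofReal (Real.exp (2 * c * σ ^ 2)) ^ (1 / 2 : ℝ) := by gcongr
    _ = _ := by
        rw [ENNReal.ofReal_rpow_of_pos (Real.exp_pos _), ENNReal.ofReal_rpow_of_pos (Real.exp_pos _),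
          ← Real.exp_mul, ← Real.exp_mul, ← ENNReal.ofReal_mul (Real.exp_pos _).le, ← Real.exp_add,
          norm_smul, Real.norm_ofNat]
        congr 2
        ring

end SubGaussian

/-! ### Conditioning on the past by Fubini; recursions driven by independent blocks. -/

section Independence

variable {Ω S T : Type*} [MeasurableSpace Ω] [MeasurableSpace S] [MeasurableSpace T]
  {P : Measure Ω} [IsProbabilityMeasure P]

theorem lintegral_le_of_indepFun {X : Ω → S} {Y : Ω → T} (hX : Measurable X) (hY : Measurable Y)
    (hXY : IndepFun X Y P) {F : S → T → ENNReal} (hF : Measurable (Function.uncurry F))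
    {c : S → ENNReal} (hc : Measurable c) (h : ∀ s, ∫⁻ ω, F s (Y ω) ∂P ≤ c s) :
    ∫⁻ ω, F (X ω) (Y ω) ∂P ≤ ∫⁻ ω, c (X ω) ∂P := by
  have := Measure.isProbabilityMeasure_map (μ := P) hX.aemeasurable
  have := Measure.isProbabilityMeasure_map (μ := P) hY.aemeasurable
  calc ∫⁻ ω, F (X ω) (Y ω) ∂P
      = ∫⁻ q, Function.uncurry F q ∂(P.map fun ω => (X ω, Y ω)) := by
        rw [lintegral_map hF (hX.prodMk hY)]; rfl
    _ = ∫⁻ s, ∫⁻ t, F s t ∂(P.map Y) ∂(P.map X) := by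
        rw [hXY.map_prod_eq_prod_map_map hX.aemeasurable hY.aemeasurable,
          MeasureTheory.lintegral_prod _ hF.aemeasurable]; rfl
    _ ≤ ∫⁻ s, c s ∂(P.map X) := by
        refine lintegral_mono fun s => ?_
        rw [lintegral_map (f := F s) (hF.comp measurable_prodMk_left) hY]
        exact h s
    _ = _ := lintegral_map hc hX

/-- A potential which does not increase in conditional mean along a Markov recursion. -/
theorem lintegral_potential_le {X : ℕ → Ω → S} {Y : ℕ → Ω → T} {step : ℕ → S → T → S}
    (hX : ∀ k, Measurable (X k)) (hY : ∀ k, Measurable (Y k))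
    (hXY : ∀ k, IndepFun (X k) (Y k) P) (hstep : ∀ k, Measurable (Function.uncurry (step k)))
    (hrec : ∀ k ω, X (k + 1) ω = step k (X k ω) (Y k ω))
    {W : ℕ → S → ENNReal} (hW : ∀ k, Measurable (W k)) {r : ℕ}
    (h : ∀ k < r, ∀ s, ∫⁻ ω, W (k + 1) (step k s (Y k ω)) ∂P ≤ W k s) :
    ∀ k ≤ r, ∫⁻ ω, W k (X k ω) ∂P ≤ ∫⁻ ω, W 0 (X 0 ω) ∂P := by
  intro k hk
  induction k with
  | zero => exact le_rfl
  | succ k ih =>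
    refine le_trans ?_ (ih (by omega))
    simp_rw [hrec]
    exact lintegral_le_of_indepFun (hX k) (hY k) (hXY k)
      (F := fun s t => W (k + 1) (step k s t)) ((hW _).comp (hstep k)) (hW k) (h k (by omega))

theorem measurable_pi_biSup_comap {Ξ ι : Type*} [MeasurableSpace Ξ] (ζ : ι → Ω → Ξ) {A : Set ι}
    {e : ℕ → ι} (he : ∀ l, e l ∈ A) :
    Measurable[⨆ i ∈ A, MeasurableSpace.comap (ζ i) inferInstance] (fun ω l => ζ (e l) ω) := by
  rw [measurable_iff_comap_le, MeasurableSpace.pi, MeasurableSpace.comap_iSup]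
  refine iSup_le fun l => ?_
  rw [MeasurableSpace.comap_comp]
  exact le_biSup (fun i => MeasurableSpace.comap (ζ i) inferInstance) (he l)

/-- The state of a recursion driven by disjoint blocks of an independent family is independent of
the next block. -/
theorem indepFun_recursion {Ξ : Type*} [MeasurableSpace Ξ] {ζ : ℕ × ℕ → Ω → Ξ}
    (hζ : ∀ i, Measurable (ζ i)) (hind : iIndepFun ζ P)
    {X : ℕ → Ω → S} {step : ℕ → S → (ℕ → Ξ) → S}
    (hstep : ∀ k, Measurable (Function.uncurry (step k))) (s₀ : S) (h0 : ∀ ω, X 0 ω = s₀)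
    (hrec : ∀ k ω, X (k + 1) ω = step k (X k ω) (fun l => ζ (k, l) ω)) (k : ℕ) :
    Measurable (X k) ∧ IndepFun (X k) (fun ω l => ζ (k, l) ω) P := by
  have hle : ∀ i, (MeasurableSpace.comap (ζ i) inferInstance) ≤ ‹MeasurableSpace Ω› :=
    fun i => (hζ i).comap_le
  -- The state is a function of the blocks before `k`; block `k` generates a σ-algebra over a
  -- disjoint index set.
  have hmeas : ∀ k, Measurable[⨆ i ∈ {i : ℕ × ℕ | i.1 < k}, MeasurableSpace.comap (ζ i) inferInstance]
      (X k) := by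
    intro k
    induction k with
    | zero =>
      have : X 0 = fun _ => s₀ := funext h0
      rw [this]
      exact measurable_const
    | succ k ih =>
      have : X (k + 1) = fun ω => Function.uncurry (step k) (X k ω, fun l => ζ (k, l) ω) :=
        funext (hrec k)
      rw [this]
      refine (hstep k).comp (Measurable.prodMk ?_ ?_)
      · refine ih.mono (biSup_mono fun i hi => ?_) le_rfl
        exact Nat.lt_succ_of_lt hi
      · exact measurable_pi_biSup_comap ζ (fun l => Nat.lt_succ_self k)
  have hY : Measurable[⨆ i ∈ {i : ℕ × ℕ | i.1 = k}, MeasurableSpace.comap (ζ i) inferInstance]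
      (fun ω l => ζ (k, l) ω) := measurable_pi_biSup_comap ζ (fun l => rfl)
  refine ⟨(hmeas k).mono (iSup₂_le fun i _ => hle i) le_rfl, ?_⟩
  have hI := indep_iSup_of_disjoint hle hind.iIndep (S := {i : ℕ × ℕ | i.1 < k})
    (T := {i : ℕ × ℕ | i.1 = k})
    (Set.disjoint_left.2 fun i (h1 : i.1 < k) (h2 : i.1 = k) => by omega)
  rw [IndepFun_iff_Indep]
  exact indep_of_indep_of_le_left (indep_of_indep_of_le_right hI hY.comap_le) (hmeas k).comap_le

end Independence

/-! ### Exponential moments of sums of independent centred vectors. -/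

section Batch

variable {E : Type*} [NormedAddCommGroup E] [InnerProductSpace ℝ E] [MeasurableSpace E]
  [BorelSpace E] [SecondCountableTopology E] [CompleteSpace E]
  {Ω : Type*} [MeasurableSpace Ω] {P : Measure Ω} [IsProbabilityMeasure P]
  {η : ℕ → Ω → E} {σ : ℝ}

theorem indepFun_sum_range (hη : ∀ l, Measurable (η l)) (hind : iIndepFun η P) (k : ℕ) :
    IndepFun (fun ω => ∑ i ∈ Finset.range k, η i ω) (η k) P := by
  have := hind.indepFun_finsetSum_of_notMem hη (s := Finset.range k) (i := k) (by simp)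
  convert this using 1
  ext ω
  simp

theorem lintegral_exp_inner_sum_le (hη : ∀ l, Measurable (η l)) (hind : iIndepFun η P)
    (hi : ∀ l, Integrable (η l) P) (h0 : ∀ l, ∫ ω, η l ω ∂P = 0)
    (h : ∀ l, ∫⁻ ω, ENNReal.ofReal (Real.exp (‖η l ω‖ ^ 2 / σ ^ 2)) ∂P
      ≤ ENNReal.ofReal (Real.exp 1))
    (hσ : 0 < σ) (w : E) (r : ℕ) :
    ∫⁻ ω, ENNReal.ofReal (Real.exp ⟪w, ∑ l ∈ Finset.range r, η l ω⟫_ℝ) ∂P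
      ≤ ENNReal.ofReal (Real.exp (r * (2 * ‖w‖ ^ 2 * σ ^ 2))) := by
  have key := lintegral_potential_le (P := P) (X := fun k ω => ∑ i ∈ Finset.range k, η i ω) (Y := η)
    (step := fun _ s y => s + y) (fun k => by fun_prop) hη (indepFun_sum_range hη hind)
    (fun k => by fun_prop) (fun k ω => Finset.sum_range_succ _ _)
    (W := fun k s => ENNReal.ofReal (Real.exp (⟪w, s⟫_ℝ + ((r : ℝ) - k) * (2 * ‖w‖ ^ 2 * σ ^ 2))))
    (fun k => by fun_prop) (r := r) ?_ r le_rfl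
  · simpa using key
  · intro k _ s
    calc _ = ∫⁻ ω, ENNReal.ofReal (Real.exp (⟪w, s⟫_ℝ + ((r : ℝ) - (k + 1)) * (2 * ‖w‖ ^ 2 * σ ^ 2)))
          * ENNReal.ofReal (Real.exp ⟪w, η k ω⟫_ℝ) ∂P := by
          refine lintegral_congr fun ω => ?_
          rw [← ENNReal.ofReal_mul (Real.exp_pos _).le, ← Real.exp_add, inner_add_right]
          congr 2
          push_cast
          ring
      _ = _ := lintegral_const_mul _ (by fun_prop)
      _ ≤ _ := by
          grw [lintegral_exp_inner_le (hη k) (hi k) (h0 k) (h k) hσ w]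
          rw [← ENNReal.ofReal_mul (Real.exp_pos _).le, ← Real.exp_add]
          refine ENNReal.ofReal_le_ofReal (Real.exp_le_exp.2 (le_of_eq ?_))
          ring

/-- Dimension-free: the squared norm of the partial sum is itself used as the exponent of a
supermartingale, with coefficients that decrease so as to absorb the cross term `2c⟨s, η⟩`. -/
theorem lintegral_exp_norm_sq_sum_le (hη : ∀ l, Measurable (η l)) (hind : iIndepFun η P)
    (hi : ∀ l, Integrable (η l) P) (h0 : ∀ l, ∫ ω, η l ω ∂P = 0)
    (h : ∀ l, ∫⁻ ω, ENNReal.ofReal (Real.exp (‖η l ω‖ ^ 2 / σ ^ 2)) ∂P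
      ≤ ENNReal.ofReal (Real.exp 1))
    (hσ : 0 < σ) {r : ℕ} (hr : 0 < r) :
    ∫⁻ ω, ENNReal.ofReal (Real.exp (‖∑ l ∈ Finset.range r, η l ω‖ ^ 2 / (32 * σ ^ 2 * r))) ∂P
      ≤ ENNReal.ofReal (Real.exp 1) := by
  have hr' : (0 : ℝ) < r := by exact_mod_cast hr
  -- Integrating out one summand turns the coefficient `c` of `‖s‖²` into `c + 16c²σ²` and adds
  -- `cσ²`. These `c k` satisfy the resulting recursion `hcrec` and stay comparable to `1 / (σ²r)`
  -- for `k ≤ r`; the `r` additive terms total at most `1/16`.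
  set c : ℕ → ℝ := fun k => (16 * σ ^ 2 * (k + r))⁻¹ with hcdef
  have hcpos : ∀ k, 0 < c k := fun k => by positivity
  have hcσ : ∀ k, c k * σ ^ 2 ≤ 1 / (16 * r) := fun k => by
    have : c k * σ ^ 2 = 1 / (16 * (k + r)) := by simp only [hcdef]; field_simp
    rw [this]
    gcongr
    simp
  have hr1 : (1 : ℝ) ≤ r := by exact_mod_cast hr
  have hcrec : ∀ k, c (k + 1) + 16 * c (k + 1) ^ 2 * σ ^ 2 ≤ c k := fun k => by
    simp only [hcdef]
    have ht : (0 : ℝ) < k + r := by positivity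
    push_cast
    have e1 : (16 * σ ^ 2 * ((k : ℝ) + 1 + r))⁻¹ + 16 * (16 * σ ^ 2 * ((k : ℝ) + 1 + r))⁻¹ ^ 2 * σ ^ 2
        = (16 * σ ^ 2)⁻¹ * ((k + r + 2) / (k + r + 1) ^ 2) := by
      field_simp
      ring
    have e2 : (16 * σ ^ 2 * ((k : ℝ) + r))⁻¹ = (16 * σ ^ 2)⁻¹ * (1 / ((k : ℝ) + r)) := by
      field_simp
    rw [e1, e2]
    refine mul_le_mul_of_nonneg_left ?_ (by positivity)
    rw [div_le_div_iff₀ (by positivity) ht]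
    nlinarith
  have key := lintegral_potential_le (P := P) (X := fun k ω => ∑ i ∈ Finset.range k, η i ω) (Y := η)
    (step := fun _ s y => s + y) (fun k => by fun_prop) hη (indepFun_sum_range hη hind)
    (fun k => by fun_prop) (fun k ω => Finset.sum_range_succ _ _)
    (W := fun k s => ENNReal.ofReal (Real.exp (c k * ‖s‖ ^ 2 + ((r : ℝ) - k) * (1 / (16 * r)))))
    (fun k => by fun_prop) (r := r) ?_ r le_rfl
  · have e : ∀ s : E, c r * ‖s‖ ^ 2 + ((r : ℝ) - r) * (1 / (16 * r)) = ‖s‖ ^ 2 / (32 * σ ^ 2 * r) := by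
      intro s
      simp only [hcdef]
      field_simp
      ring
    simp only [e] at key
    refine key.trans ?_
    simp only [Finset.range_zero, Finset.sum_empty, lintegral_const, measure_univ, mul_one]
    refine ENNReal.ofReal_le_ofReal (Real.exp_le_exp.2 ?_)
    have : (r : ℝ) * (1 / (16 * r)) = 1 / 16 := by field_simp
    simp only [norm_zero, Nat.cast_zero, sub_zero, this]
    norm_num
  · intro k _ s
    calc _ = ∫⁻ ω, ENNReal.ofReal (Real.exp (c (k + 1) * ‖s‖ ^ 2 + ((r : ℝ) - (k + 1)) * (1 / (16 * r))))
          * ENNReal.ofReal (Real.exp (⟪(2 * c (k + 1)) • s, η k ω⟫_ℝ + c (k + 1) * ‖η k ω‖ ^ 2)) ∂P := by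
          refine lintegral_congr fun ω => ?_
          rw [← ENNReal.ofReal_mul (Real.exp_pos _).le, ← Real.exp_add, real_inner_smul_left,
            norm_add_sq_real]
          congr 2
          push_cast
          ring
      _ = _ := lintegral_const_mul _ (by fun_prop)
      _ ≤ _ := by
          have h2 : 2 * c (k + 1) * σ ^ 2 ≤ 1 := by
            have := hcσ (k + 1)
            have : 1 / (16 * (r : ℝ)) ≤ 1 / 16 := by
              gcongr
              linarith
            linarith
          grw [lintegral_exp_inner_add_le (hη k) (hi k) (h0 k) (h k) hσ _ (hcpos _).le h2]
          rw [← ENNReal.ofReal_mul (Real.exp_pos _).le, ← Real.exp_add]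
          refine ENNReal.ofReal_le_ofReal (Real.exp_le_exp.2 ?_)
          rw [norm_smul, mul_pow, Real.norm_of_nonneg (by have := hcpos (k + 1); positivity)]
          have := mul_le_mul_of_nonneg_right (hcrec k) (sq_nonneg ‖s‖)
          have := hcσ (k + 1)
          nlinarith

end Batch

/-! ### Growth of the weights. -/

section StepWeight

theorem stepWeight_pos {A L : ℝ} (hL : 0 < L) : 0 < stepWeight A L := by
  unfold stepWeight
  positivity

theorem add_stepWeight {A L : ℝ} (hA : 0 ≤ A) (hL : 0 < L) :
    A + stepWeight A L = 2 * L * stepWeight A L ^ 2 := by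
  have h : √(1 + 8 * A * L) ^ 2 = 1 + 8 * A * L := Real.sq_sqrt (by positivity)
  unfold stepWeight
  generalize √(1 + 8 * A * L) = s at h
  field_simp
  linear_combination -2 * h

theorem add_stepWeight_le {A L l k : ℝ} (hl : 0 < l) (hL : l ≤ L) (hk : 0 ≤ k)
    (hA : A ≤ k ^ 2 / (2 * l)) : A + stepWeight A L ≤ (k + 1) ^ 2 / (2 * l) := by
  have hL0 : 0 < L := hl.trans_le hL
  have hs : √(1 + 8 * A * L) ≤ 1 + 2 * k * (L / l) := by
    have h1 : 1 ≤ L / l := (one_le_div hl).2 hL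
    have h2 : A * L ≤ k ^ 2 * (L / l) / 2 := by
      calc A * L ≤ k ^ 2 / (2 * l) * L := by gcongr
        _ = _ := by field_simp
    refine Real.sqrt_le_iff.2 ⟨by positivity, ?_⟩
    nlinarith [mul_le_mul_of_nonneg_left h1 (by positivity : 0 ≤ k ^ 2 * (L / l)),
      (by positivity : 0 ≤ k * (L / l))]
  have ha : stepWeight A L ≤ (1 + k) / (2 * l) := by
    unfold stepWeight
    rw [div_le_div_iff₀ (by positivity) (by positivity)]
    have : (1 + √(1 + 8 * A * L)) * (2 * l) ≤ (2 + 2 * k * (L / l)) * (2 * l) := by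
      exact mul_le_mul_of_nonneg_right (by linarith) (by positivity)
    have e : (2 + 2 * k * (L / l)) * (2 * l) = 4 * l + 4 * k * L := by field_simp; ring
    nlinarith
  calc A + stepWeight A L ≤ k ^ 2 / (2 * l) + (1 + k) / (2 * l) := add_le_add hA ha
    _ = (k ^ 2 + k + 1) / (2 * l) := by ring
    _ ≤ _ := by gcongr; nlinarith

theorem le_add_stepWeight {A L l k : ℝ} (hL0 : 0 < L) (hL : L ≤ l) (hk : 0 ≤ k)
    (hA : k ^ 2 / (8 * l) ≤ A) : (k + 1) ^ 2 / (8 * l) ≤ A + stepWeight A L := by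
  have hl : 0 < l := hL0.trans_le hL
  have hs : k * (L / l) ≤ √(1 + 8 * A * L) := by
    refine Real.le_sqrt_of_sq_le ?_
    have h1 : L / l ≤ 1 := (div_le_one hl).2 hL
    have h2 : k ^ 2 * (L / l) / 8 ≤ A * L := by
      calc _ = k ^ 2 / (8 * l) * L := by field_simp
        _ ≤ A * L := by gcongr
    nlinarith [mul_le_mul_of_nonneg_left h1 (by positivity : 0 ≤ k ^ 2 * (L / l))]
  have ha : (1 + k) / (4 * l) ≤ stepWeight A L := by
    unfold stepWeight
    rw [div_le_div_iff₀ (by positivity) (by positivity)]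
    have : (1 + k * (L / l)) * (4 * l) ≤ (1 + √(1 + 8 * A * L)) * (4 * l) := by gcongr
    have e : (1 + k * (L / l)) * (4 * l) = 4 * l + 4 * k * L := by field_simp
    nlinarith
  calc (k + 1) ^ 2 / (8 * l) ≤ (k ^ 2 + 2 * k + 2) / (8 * l) := by gcongr; nlinarith
    _ = k ^ 2 / (8 * l) + (1 + k) / (4 * l) := by field_simp; ring
    _ ≤ _ := add_le_add hA ha

/-- This makes the batches of rejected passes summable over the exponent. The true decay is of order
`2 ^ (-e/2)`; the ratio `3/4` is a rational substitute, available because `2 ≤ (3/2)²`. -/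
theorem stepWeight_two_pow_le {A l k : ℝ} (hl : 0 < l) (hk : 1 ≤ k)
    (hA : A ≤ k ^ 2 / (2 * l)) (e : ℕ) :
    stepWeight A (2 ^ e * l) ≤ k / l * (3 / 4) ^ e := by
  have h2 : (1 : ℝ) ≤ (3 / 2) ^ e := one_le_pow₀ (by norm_num)
  have hs : √(1 + 8 * A * (2 ^ e * l)) ≤ 1 + 2 * k * (3 / 2) ^ e := by
    have h1 : A * (2 ^ e * l) ≤ k ^ 2 * 2 ^ e / 2 := by
      calc A * (2 ^ e * l) ≤ k ^ 2 / (2 * l) * (2 ^ e * l) := by gcongr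
        _ = _ := by field_simp
    have h3 : (2 : ℝ) ^ e ≤ ((3 / 2) ^ e) ^ 2 := by
      rw [← pow_mul, mul_comm, pow_mul]
      gcongr
      norm_num
    refine Real.sqrt_le_iff.2 ⟨by positivity, ?_⟩
    nlinarith [mul_le_mul_of_nonneg_left h3 (sq_nonneg k), (by positivity : 0 ≤ k * (3 / 2) ^ e)]
  unfold stepWeight
  have he : (3 / 4 : ℝ) ^ e = (3 / 2) ^ e / 2 ^ e := by rw [← div_pow]; norm_num
  rw [he, div_mul_div_comm, div_le_div_iff₀ (by positivity) (by positivity)]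
  have : 1 ≤ k * (3 / 2 : ℝ) ^ e := by nlinarith
  have h4 : 1 + √(1 + 8 * A * (2 ^ e * l)) ≤ 4 * (k * (3 / 2) ^ e) := by linarith
  calc _ ≤ 4 * (k * (3 / 2) ^ e) * (l * 2 ^ e) := by gcongr
    _ = _ := by ring

end StepWeight

/-! ### Deterministic sequences of constants and weights for prescribed passes. -/

section Parameters

/-- The constraints on the parameters of the method that its analysis uses; the initial constant is
`2 ^ j₀ * Llow`. -/
structure Params.Valid (p : Params) (j₀ : ℕ) : Prop where
  Llow_pos : 0 < p.Llow
  one_le_m : 1 ≤ p.m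
  Lbar_eq : p.Lbar = 2 ^ p.m * p.Llow
  j₀_le : j₀ ≤ p.m
  L₀_eq : p.L₀ = 2 ^ j₀ * p.Llow
  ε_pos : 0 < p.ε
  σ₀_pos : 0 < p.σ₀
  α_pos : 0 < p.α
  α_lt_one : p.α < 1
  b_pos : 0 < p.b
  two_le_N : 2 ≤ p.N

variable {p : Params} {j₀ : ℕ}

/-- The halving that opens an iteration is undone by the doubling that opens its first pass, except
at exponent `0`, which moves up to `1`. Hence exponents never decrease along a run. -/
theorem two_mul_max_half {l : ℝ} (hl : 0 < l) (e : ℕ) :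
    2 * max (2 ^ e * l / 2) l = 2 ^ max e 1 * l := by
  cases e with
  | zero => rw [max_eq_right (by simp; linarith)]; simp
  | succ e =>
    have h1 : (2 : ℝ) ^ (e + 1) * l / 2 = 2 ^ e * l := by ring
    have h2 : (1 : ℝ) ≤ 2 ^ e := one_le_pow₀ (by norm_num)
    rw [h1, max_eq_left (by nlinarith), max_eq_left (by omega)]
    ring

theorem min_two_pow_mul {l : ℝ} (hl : 0 < l) (a b : ℕ) :
    min ((2 : ℝ) ^ a * l) (2 ^ b * l) = 2 ^ min a b * l := by
  have h : Monotone fun e : ℕ => (2 : ℝ) ^ e * l := fun a b hab => by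
    dsimp only
    gcongr
    norm_num
  exact (h.map_min (a := a) (b := b)).symm

theorem Params.Valid.trialL_two_pow (h : p.Valid j₀) (e j : ℕ) :
    p.trialL (2 ^ e * p.Llow) j = 2 ^ min (max e 1 + j) p.m * p.Llow := by
  have hm := h.one_le_m
  induction j with
  | zero =>
    rw [Params.trialL, two_mul_max_half h.Llow_pos, h.Lbar_eq, min_two_pow_mul h.Llow_pos, add_zero]
  | succ j ih =>
    rw [Params.trialL, ih, h.Lbar_eq, ← mul_assoc, ← pow_succ', min_two_pow_mul h.Llow_pos]
    congr 2
    omega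

theorem Params.Valid.logFactor_pos (h : p.Valid j₀) : 0 < p.logFactor := by
  have h1 : 0 < Real.log p.α⁻¹ := Real.log_pos ((one_lt_inv₀ h.α_pos).2 h.α_lt_one)
  have h2 : 0 ≤ Real.log p.N := Real.log_natCast_nonneg _
  unfold Params.logFactor
  positivity

theorem Params.Valid.Lbar_pos (h : p.Valid j₀) : 0 < p.Lbar := by
  have := h.Llow_pos
  rw [h.Lbar_eq]
  positivity

/-- The number of samples per unit of weight. -/
def Params.batchRate (p : Params) : ℝ :=
  p.b * (p.σ₀ ^ 2 * p.Lbar ^ 2 / (p.ε * p.Llow ^ 2) * p.logFactor)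

theorem Params.Valid.batchRate_pos (h : p.Valid j₀) : 0 < p.batchRate := by
  have := h.logFactor_pos
  have := h.Lbar_pos
  have := h.Llow_pos
  have := h.ε_pos
  have := h.σ₀_pos
  have := h.b_pos
  unfold Params.batchRate
  positivity

theorem Params.one_le_batchSize (a : ℝ) : 1 ≤ p.batchSize a := le_max_right _ _

theorem Params.batchRate_mul_le (a : ℝ) : p.batchRate * a ≤ p.batchSize a := by
  unfold Params.batchSize
  push_cast
  refine le_trans (le_trans (le_of_eq ?_) (Nat.le_ceil _)) (le_max_left _ _)
  unfold Params.batchRate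
  ring

theorem Params.Valid.batchSize_le (h : p.Valid j₀) {a : ℝ} (ha : 0 ≤ a) :
    (p.batchSize a : ℝ) ≤ p.batchRate * a + 1 := by
  have e : p.b * (a * p.σ₀ ^ 2 * p.Lbar ^ 2 / (p.ε * p.Llow ^ 2) * p.logFactor)
      = p.batchRate * a := by
    unfold Params.batchRate
    ring
  have h0 : 0 ≤ p.batchRate * a := mul_nonneg h.batchRate_pos.le ha
  unfold Params.batchSize
  rw [e]
  push_cast
  exact max_le (Nat.ceil_lt_add_one h0).le (by linarith)

/-- The exponents `e` of the constants `2 ^ e * Llow` kept by the iterations when the `pass k`-th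
pass is kept in iteration `k`. -/
def Params.exponentSeq (p : Params) (j₀ : ℕ) (pass : ℕ → ℕ) : ℕ → ℕ
  | 0 => j₀
  | k + 1 => min (max (p.exponentSeq j₀ pass k) 1 + pass k) p.m

/-- The constants kept by the iterations when the `pass k`-th pass is kept in iteration `k`. -/
def Params.constSeq (p : Params) (pass : ℕ → ℕ) : ℕ → ℝ
  | 0 => p.L₀
  | k + 1 => p.trialL (p.constSeq pass k) (pass k)

/-- The sums of weights when the `pass k`-th pass is kept in iteration `k`. -/
def Params.weightSum (p : Params) (pass : ℕ → ℕ) : ℕ → ℝ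
  | 0 => 0
  | k + 1 => p.weightSum pass k + stepWeight (p.weightSum pass k) (p.constSeq pass (k + 1))

/-- The weight of iteration `k` when the `pass k`-th pass is kept in iteration `k`. -/
def Params.weight (p : Params) (pass : ℕ → ℕ) (k : ℕ) : ℝ :=
  stepWeight (p.weightSum pass k) (p.constSeq pass (k + 1))

variable {pass : ℕ → ℕ}

theorem Params.Valid.exponentSeq_le (h : p.Valid j₀) (k : ℕ) : p.exponentSeq j₀ pass k ≤ p.m := by
  cases k with
  | zero => exact h.j₀_le
  | succ k => exact min_le_right _ _

theorem Params.Valid.constSeq_eq (h : p.Valid j₀) (k : ℕ) :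
    p.constSeq pass k = 2 ^ p.exponentSeq j₀ pass k * p.Llow := by
  induction k with
  | zero => exact h.L₀_eq
  | succ k ih => rw [constSeq, ih, h.trialL_two_pow, exponentSeq]

theorem Params.Valid.Llow_le_constSeq (h : p.Valid j₀) (k : ℕ) : p.Llow ≤ p.constSeq pass k := by
  rw [h.constSeq_eq]
  exact le_mul_of_one_le_left h.Llow_pos.le (one_le_pow₀ (by norm_num))

theorem Params.Valid.constSeq_le_Lbar (h : p.Valid j₀) (k : ℕ) : p.constSeq pass k ≤ p.Lbar := by
  have := h.Llow_pos
  rw [h.constSeq_eq, h.Lbar_eq]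
  gcongr
  · norm_num
  · exact h.exponentSeq_le k

theorem Params.Valid.constSeq_pos (h : p.Valid j₀) (k : ℕ) : 0 < p.constSeq pass k :=
  h.Llow_pos.trans_le (h.Llow_le_constSeq k)

theorem Params.Valid.weight_pos (h : p.Valid j₀) (k : ℕ) : 0 < p.weight pass k :=
  stepWeight_pos (h.constSeq_pos _)

theorem Params.weightSum_succ (k : ℕ) :
    p.weightSum pass (k + 1) = p.weightSum pass k + p.weight pass k := rfl

theorem Params.weightSum_eq_sum (k : ℕ) :
    p.weightSum pass k = ∑ i ∈ Finset.range k, p.weight pass i := by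
  induction k with
  | zero => rfl
  | succ k ih => rw [Finset.sum_range_succ, ← ih, weightSum_succ]

theorem Params.Valid.weightSum_nonneg (h : p.Valid j₀) (k : ℕ) : 0 ≤ p.weightSum pass k := by
  rw [weightSum_eq_sum]
  exact Finset.sum_nonneg fun i _ => (h.weight_pos i).le

theorem Params.Valid.weightSum_mono (h : p.Valid j₀) : Monotone (p.weightSum pass) :=
  monotone_nat_of_le_succ fun k => by
    rw [weightSum_succ]
    exact le_add_of_nonneg_right (h.weight_pos k).le

theorem Params.Valid.weightSum_le (h : p.Valid j₀) (k : ℕ) :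
    p.weightSum pass k ≤ k ^ 2 / (2 * p.Llow) := by
  induction k with
  | zero => simp [weightSum]
  | succ k ih =>
    push_cast
    exact add_stepWeight_le h.Llow_pos (h.Llow_le_constSeq _)
      (Nat.cast_nonneg k) ih

theorem Params.Valid.le_weightSum (h : p.Valid j₀) (k : ℕ) :
    k ^ 2 / (8 * p.Lbar) ≤ p.weightSum pass k := by
  induction k with
  | zero => simp [weightSum]
  | succ k ih =>
    push_cast
    exact le_add_stepWeight (h.constSeq_pos _) (h.constSeq_le_Lbar _) (Nat.cast_nonneg k) ih

end Parameters

/-! ### One step: sufficient condition for the test, and change of the potential. -/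

section Step

variable {n : ℕ} {Ξ : Type*} {f : Vec n → ℝ} {G : Vec n → Ξ → Vec n} {p : Params}

theorem HasLipschitzGradient.differentiable {L : ℝ} (h : HasLipschitzGradient f L) :
    Differentiable ℝ f := h.1.differentiable one_ne_zero

theorem _root_.ConvexOn.add_inner_gradient_le (hf : ConvexOn ℝ Set.univ f)
    (hd : Differentiable ℝ f) (x y : Vec n) : f x + ⟪∇ f x, y - x⟫_ℝ ≤ f y := by
  have hline : HasDerivAt (fun t : ℝ => f (AffineMap.lineMap x y t)) (⟪∇ f x, y - x⟫_ℝ) 0 := by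
    have h1 : HasFDerivAt f (fderiv ℝ f x) (AffineMap.lineMap x y (0 : ℝ)) := by
      rw [AffineMap.lineMap_apply_zero]
      exact (hd x).hasFDerivAt
    have := h1.comp_hasDerivAt (0 : ℝ) (AffineMap.hasDerivAt_lineMap (a := x) (b := y))
    rwa [← inner_gradient_left] at this
  have hc : ConvexOn ℝ Set.univ (fun t : ℝ => f (AffineMap.lineMap x y t)) := by
    have := hf.comp_affineMap (AffineMap.lineMap (k := ℝ) x y)
    rw [Set.preimage_univ] at this
    exact this
  have := hc.le_slope_of_hasDerivAt (Set.mem_univ 0) (Set.mem_univ 1) zero_lt_one hline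
  simp only [slope_def_field, AffineMap.lineMap_apply_one, AffineMap.lineMap_apply_zero] at this
  linarith

variable (f G p) in
/-- The error of the mini-batch gradient in a pass with constant `L` and samples `z`. -/
def trialNoise (s : State n) (L : ℝ) (z : ℕ → Ξ) : Vec n :=
  trialGrad G p s L z - ∇ f (trialY s L)

theorem trialX_sub_trialY (s : State n) (L : ℝ) (z : ℕ → Ξ) :
    trialX G p s L z - trialY s L
      = -(((s.A + stepWeight s.A L)⁻¹ * stepWeight s.A L ^ 2) • trialGrad G p s L z) := by
  unfold trialX trialY trialU
  module

/-- The test allows `L'‖d‖²`, twice what the descent lemma needs. The spare half absorbs `‖δ‖‖d‖` by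
Young's inequality, and the remainder `‖δ‖² / (2L')` fits into the `ε`-allowance because `A + a =
2L'a²`. -/
theorem accept_of_norm_trialNoise_le {L L' : ℝ} (hf : HasLipschitzGradient f L) (hL' : 0 < L')
    (hLL : L ≤ L') {s : State n} (hA : 0 ≤ s.A) {z : ℕ → Ξ}
    (hz : ‖trialNoise f G p s L' z‖ ^ 2 ≤ p.ε / (2 * stepWeight s.A L')) :
    Accept f G p s L' z := by
  have ha : 0 < stepWeight s.A L' := stepWeight_pos hL'
  have h := hf.2 (trialY s L') (trialX G p s L' z)
  rw [norm_sub_rev] at h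
  unfold Accept
  set d := trialX G p s L' z - trialY s L' with hd
  have hg : trialGrad G p s L' z = ∇ f (trialY s L') + trialNoise f G p s L' z := by
    unfold trialNoise
    abel
  rw [hg, inner_add_left, add_stepWeight hA hL']
  set δ := trialNoise f G p s L' z
  have h1 : -⟪δ, d⟫_ℝ ≤ ‖δ‖ * ‖d‖ := by
    have := abs_le.1 (abs_real_inner_le_norm δ d)
    linarith
  have h2 : ‖δ‖ * ‖d‖ ≤ ‖δ‖ ^ 2 / (2 * L') + L' / 2 * ‖d‖ ^ 2 := by
    have : ‖δ‖ ^ 2 / (2 * L') + L' / 2 * ‖d‖ ^ 2 - ‖δ‖ * ‖d‖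
        = (‖δ‖ - L' * ‖d‖) ^ 2 / (2 * L') := by
      field_simp
      ring
    have : 0 ≤ (‖δ‖ - L' * ‖d‖) ^ 2 / (2 * L') := by positivity
    linarith
  have h3 : ‖δ‖ ^ 2 / (2 * L')
      ≤ stepWeight s.A L' / (2 * (2 * L' * stepWeight s.A L' ^ 2)) * p.ε := by
    calc _ ≤ p.ε / (2 * stepWeight s.A L') / (2 * L') := by gcongr
      _ = _ := by field_simp
  have h4 : L / 2 * ‖d‖ ^ 2 ≤ L' / 2 * ‖d‖ ^ 2 := by gcongr
  linarith

/-- One accepted pass changes the potential `A (f x - f v) + ‖u - v‖² / 2` by a noise term and by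
the allowance of the stopping test. -/
theorem potential_step_le (hf : ConvexOn ℝ Set.univ f) (hd : Differentiable ℝ f) {s : State n}
    (hA : 0 ≤ s.A) {L : ℝ} (hL : 0 < L) {z : ℕ → Ξ} (hacc : Accept f G p s L z) (v : Vec n) :
    (s.A + stepWeight s.A L) * (f (trialX G p s L z) - f v) + ‖trialU G p s L z - v‖ ^ 2 / 2
      ≤ s.A * (f s.x - f v) + ‖s.u - v‖ ^ 2 / 2
        + stepWeight s.A L * ⟪trialNoise f G p s L z, v - s.u⟫_ℝ + stepWeight s.A L * p.ε / 2 := by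
  have ha : 0 < stepWeight s.A L := stepWeight_pos hL
  have hAa := add_stepWeight hA hL
  have hB : 0 < s.A + stepWeight s.A L := by positivity
  have hxy := trialX_sub_trialY (G := G) (p := p) s L z
  unfold Accept at hacc
  rw [hxy] at hacc
  have hu : trialU G p s L z - v = (s.u - v) - stepWeight s.A L • trialGrad G p s L z := by
    unfold trialU
    abel
  have hy : (s.A + stepWeight s.A L) • trialY s L = stepWeight s.A L • s.u + s.A • s.x := by
    unfold trialY
    rw [smul_inv_smul₀ hB.ne']
  have c1 := hf.add_inner_gradient_le hd (trialY s L) s.x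
  have c2 := hf.add_inner_gradient_le hd (trialY s L) v
  have hg : trialGrad G p s L z = ∇ f (trialY s L) + trialNoise f G p s L z := by
    unfold trialNoise
    abel
  -- Since `y` is the weighted mean of `u` and `x`, moving from `v` to `u` with weight `a` splits
  -- into the two directions to which convexity at `y` applies.
  have hiy : stepWeight s.A L * ⟪∇ f (trialY s L), s.u - v⟫_ℝ
      = - (s.A * ⟪∇ f (trialY s L), s.x - trialY s L⟫_ℝ)
        - stepWeight s.A L * ⟪∇ f (trialY s L), v - trialY s L⟫_ℝ := by
    have e : stepWeight s.A L • (s.u - v)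
        = -(s.A • (s.x - trialY s L)) - stepWeight s.A L • (v - trialY s L) := by
      have : stepWeight s.A L • s.u = (s.A + stepWeight s.A L) • trialY s L - s.A • s.x := by
        rw [hy]; abel
      rw [smul_sub, this]
      module
    rw [← real_inner_smul_right, e, inner_sub_right, inner_neg_right, real_inner_smul_right,
      real_inner_smul_right]
  rw [hu, norm_sub_sq_real, real_inner_smul_right, norm_smul, Real.norm_of_nonneg ha.le]
  rw [inner_neg_right, real_inner_smul_right, real_inner_self_eq_norm_sq, norm_neg, norm_smul,
    Real.norm_of_nonneg (by positivity)] at hacc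
  have hgu : ⟪s.u - v, trialGrad G p s L z⟫_ℝ
      = ⟪∇ f (trialY s L), s.u - v⟫_ℝ - ⟪trialNoise f G p s L z, v - s.u⟫_ℝ := by
    rw [real_inner_comm, hg, inner_add_left, ← neg_sub s.u v, inner_neg_right]
    ring
  rw [hgu]
  set a := stepWeight s.A L
  set g2 := ‖trialGrad G p s L z‖
  -- With `A + a = 2La²`, the linear and quadratic terms of the test combine to `-a²‖g‖²/2`, which
  -- cancels the square from expanding `‖u - a g - v‖² / 2`.
  have hacc' : (s.A + a) * f (trialX G p s L z)
      ≤ (s.A + a) * f (trialY s L) - a ^ 2 * g2 ^ 2 / 2 + a * p.ε / 2 := by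
    have := mul_le_mul_of_nonneg_left hacc hB.le
    refine this.trans (le_of_eq ?_)
    rw [hAa]
    field_simp
    ring
  nlinarith [mul_le_mul_of_nonneg_left c1 hA, mul_le_mul_of_nonneg_left c2 ha.le]

end Step

/-! ### Runs with prescribed passes, and their coincidence with the method. -/

section ForcedRun

variable {n : ℕ} {Ξ : Type*} (f : Vec n → ℝ) (G : Vec n → Ξ → Vec n) (p : Params)

/-- The state after an iteration whose `j`-th pass, with samples `z`, is kept. -/
def passState (s : State n) (j : ℕ) (z : ℕ → Ξ) : State n where
  A := s.A + stepWeight s.A (p.trialL s.L j)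
  L := p.trialL s.L j
  x := trialX G p s (p.trialL s.L j) z
  u := trialU G p s (p.trialL s.L j) z
  calls := s.calls + ∑ i ∈ Finset.range (j + 1), trialBatch p s (p.trialL s.L i)

/-- The run in which the `pass k`-th pass, with samples `z k`, is kept in iteration `k`, whatever
the result of the stopping test. -/
def forcedRun (x₀ : Vec n) (pass : ℕ → ℕ) (z : ℕ → ℕ → Ξ) : ℕ → State n
  | 0 => { A := 0, L := p.L₀, x := x₀, u := x₀, calls := 0 }
  | k + 1 => passState G p (forcedRun x₀ pass z k) (pass k) (z k)

/-- The error of the mini-batch gradient in iteration `k` of the forced run. -/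
def forcedNoise (x₀ : Vec n) (pass : ℕ → ℕ) (z : ℕ → ℕ → Ξ) (k : ℕ) : Vec n :=
  trialNoise f G p (forcedRun G p x₀ pass z k) (p.constSeq pass (k + 1)) (z k)

/-- Vectors of norm greater than `D` are replaced with `0`. -/
def clip (D : ℝ) (v : Vec n) : Vec n := if ‖v‖ ≤ D then v else 0

/-- The accumulated noise term in the potential along the forced run. -/
def noiseSum (x₀ v : Vec n) (D : ℝ) (pass : ℕ → ℕ) (z : ℕ → ℕ → Ξ) (k : ℕ) : ℝ :=
  ∑ i ∈ Finset.range k,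
    p.weight pass i * ⟪forcedNoise f G p x₀ pass z i, clip D (v - (forcedRun G p x₀ pass z i).u)⟫_ℝ

variable {f G p} {x₀ v : Vec n} {pass : ℕ → ℕ} {z : ℕ → ℕ → Ξ} {j₀ : ℕ}

theorem norm_clip_le {D : ℝ} (hD : 0 ≤ D) (v : Vec n) : ‖clip D v‖ ≤ D := by
  unfold clip
  split_ifs with h
  · exact h
  · simpa using hD

theorem forcedRun_L (k : ℕ) : (forcedRun G p x₀ pass z k).L = p.constSeq pass k := by
  induction k with
  | zero => rfl
  | succ k ih => rw [Params.constSeq, ← ih]; rfl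

theorem forcedRun_A (k : ℕ) : (forcedRun G p x₀ pass z k).A = p.weightSum pass k := by
  induction k with
  | zero => rfl
  | succ k ih =>
    rw [Params.weightSum, Params.constSeq, ← ih, ← forcedRun_L (G := G) (x₀ := x₀) (z := z)]
    rfl

theorem forcedRun_congr {pass' : ℕ → ℕ} {z' : ℕ → ℕ → Ξ} {k : ℕ} (hp : ∀ i < k, pass i = pass' i)
    (hz : ∀ i < k, z i = z' i) : forcedRun G p x₀ pass z k = forcedRun G p x₀ pass' z' k := by
  induction k with
  | zero => rfl
  | succ k ih =>
    rw [forcedRun, forcedRun, ih (fun i hi => hp i (by omega)) (fun i hi => hz i (by omega)),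
      hp k (by omega), hz k (by omega)]

theorem Params.constSeq_congr {pass' : ℕ → ℕ} {k : ℕ} (hp : ∀ i < k, pass i = pass' i) :
    p.constSeq pass k = p.constSeq pass' k := by
  induction k with
  | zero => rfl
  | succ k ih => rw [constSeq, constSeq, ih (fun i hi => hp i (by omega)), hp k (by omega)]

theorem Params.weightSum_congr {pass' : ℕ → ℕ} {k : ℕ} (hp : ∀ i < k, pass i = pass' i) :
    p.weightSum pass k = p.weightSum pass' k := by
  induction k with
  | zero => rfl
  | succ k ih => rw [weightSum, weightSum, ih (fun i hi => hp i (by omega)), constSeq_congr hp]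

theorem Params.exponentSeq_congr {pass' : ℕ → ℕ} {k : ℕ} (hp : ∀ i < k, pass i = pass' i) :
    p.exponentSeq j₀ pass k = p.exponentSeq j₀ pass' k := by
  induction k with
  | zero => rfl
  | succ k ih => rw [exponentSeq, exponentSeq, ih (fun i hi => hp i (by omega)), hp k (by omega)]

/-- As long as the accumulated noise is bounded, the potential is at most its initial value plus the
accumulated noise and the allowances of the stopping tests. -/
theorem potential_le (hf : ConvexOn ℝ Set.univ f) (hd : Differentiable ℝ f) (hmin : ∀ x, f v ≤ f x)
    (hp : p.Valid j₀) {D : ℝ} (hD : 0 ≤ D) {N : ℕ}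
    (hDN : 3 * ‖x₀ - v‖ ^ 2 + p.weightSum pass N * p.ε ≤ D ^ 2)
    (hacc : ∀ k < N, Accept f G p (forcedRun G p x₀ pass z k) (p.constSeq pass (k + 1)) (z k))
    (hM : ∀ k < N, noiseSum f G p x₀ v D pass z (k + 1) ≤ ‖x₀ - v‖ ^ 2) :
    ∀ k ≤ N, p.weightSum pass k * (f (forcedRun G p x₀ pass z k).x - f v)
        + ‖(forcedRun G p x₀ pass z k).u - v‖ ^ 2 / 2
      ≤ ‖x₀ - v‖ ^ 2 / 2 + noiseSum f G p x₀ v D pass z k + p.weightSum pass k * p.ε / 2 := by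
  intro k hk
  induction k with
  | zero => simp [Params.weightSum, noiseSum, forcedRun]
  | succ k ih =>
    have ih := ih (by omega)
    have hMk : noiseSum f G p x₀ v D pass z k ≤ ‖x₀ - v‖ ^ 2 := by
      cases k with
      | zero => simp [noiseSum]
      | succ k => exact hM k (by omega)
    have hA := hp.weightSum_nonneg (pass := pass) k
    have hAN := mul_le_mul_of_nonneg_right
      (hp.weightSum_mono (pass := pass) (show k ≤ N by omega)) hp.ε_pos.le
    have hfx := mul_nonneg hA (sub_nonneg.2 (hmin (forcedRun G p x₀ pass z k).x))
    -- The induction hypothesis gives `‖u - v‖² ≤ R² + 2R² + A_k ε ≤ D²`, so the clipping is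
    -- inactive; this is the origin of the `3` in `hDN`.
    have hclip : clip D (v - (forcedRun G p x₀ pass z k).u) = v - (forcedRun G p x₀ pass z k).u := by
      refine if_pos ?_
      rw [norm_sub_rev]
      refine abs_le_of_sq_le_sq' ?_ hD |>.2
      linarith
    have hstep := potential_step_le hf hd (by rw [forcedRun_A]; exact hA) (hp.constSeq_pos _)
      (hacc k (by omega)) v
    rw [forcedRun_A] at hstep
    have hM' : noiseSum f G p x₀ v D pass z (k + 1) = noiseSum f G p x₀ v D pass z k
        + p.weight pass k
          * ⟪forcedNoise f G p x₀ pass z k, v - (forcedRun G p x₀ pass z k).u⟫_ℝ := by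
      unfold noiseSum
      rw [Finset.sum_range_succ, hclip]
    have hx : (forcedRun G p x₀ pass z (k + 1)).x
        = trialX G p (forcedRun G p x₀ pass z k) (p.constSeq pass (k + 1)) (z k) := by
      rw [Params.constSeq, ← forcedRun_L (G := G) (x₀ := x₀) (z := z)]; rfl
    have hu : (forcedRun G p x₀ pass z (k + 1)).u
        = trialU G p (forcedRun G p x₀ pass z k) (p.constSeq pass (k + 1)) (z k) := by
      rw [Params.constSeq, ← forcedRun_L (G := G) (x₀ := x₀) (z := z)]; rfl
    rw [hx, hu, hM', Params.weightSum_succ]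
    unfold forcedNoise Params.weight
    linarith

open Classical in
theorem iterate_eq_passState {s : State n} {w : ℕ → ℕ → Ξ}
    (h : ∃ j, Accept f G p s (p.trialL s.L j) (w j)) :
    iterate f G p s w = some (passState G p s (Nat.find h) (w (Nat.find h))) := by
  unfold iterate
  rw [dif_pos h]
  rfl

/-- The number of samples of one iteration which keeps its `j`-th pass. -/
theorem sum_trialBatch_le (hp : p.Valid j₀) {N : ℝ} (hN : 1 ≤ N) {s : State n}
    (hA : s.A ≤ N ^ 2 / (2 * p.Llow)) {e j : ℕ} (hL : s.L = 2 ^ e * p.Llow)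
    (hj : max e 1 + j ≤ p.m) :
    (∑ i ∈ Finset.range (j + 1), trialBatch p s (p.trialL s.L i) : ℝ)
      ≤ p.batchRate * (stepWeight s.A (p.trialL s.L j)
          + N / p.Llow * (∑ i ∈ Finset.range (max e 1 + j), (3 / 4 : ℝ) ^ i
            - ∑ i ∈ Finset.range e, (3 / 4 : ℝ) ^ i)) + j + 1 := by
  have hl := hp.Llow_pos
  have ht : ∀ i ≤ j, p.trialL s.L i = 2 ^ (max e 1 + i) * p.Llow := fun i hi => by
    rw [hL, hp.trialL_two_pow, min_eq_left (by omega)]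
  have hb := hp.batchRate_pos
  have h1 : ∀ i ∈ Finset.range j, (trialBatch p s (p.trialL s.L i) : ℝ)
      ≤ p.batchRate * (N / p.Llow) * (3 / 4) ^ (max e 1 + i) + 1 := by
    intro i hi
    have hi' : i ≤ j := (Finset.mem_range.1 hi).le
    rw [ht i hi']
    refine (hp.batchSize_le (stepWeight_pos (by positivity)).le).trans ?_
    grw [stepWeight_two_pow_le hl hN hA]
    rw [mul_assoc]
  have h2 : (trialBatch p s (p.trialL s.L j) : ℝ)
      ≤ p.batchRate * stepWeight s.A (p.trialL s.L j) + 1 :=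
    hp.batchSize_le (by rw [ht j le_rfl]; exact (stepWeight_pos (by positivity)).le)
  -- No pass uses exponent `0`. When `e = 0` its term is added anyway, so that the bound telescopes
  -- over iterations.
  have h3 : ∑ i ∈ Finset.range e, (3 / 4 : ℝ) ^ i ≤ ∑ i ∈ Finset.range (max e 1), (3 / 4 : ℝ) ^ i :=
    Finset.sum_le_sum_of_subset_of_nonneg (Finset.range_mono (le_max_left _ _))
      fun i _ _ => by positivity
  have h4 := Finset.sum_le_sum h1
  rw [Finset.sum_add_distrib, ← Finset.mul_sum] at h4
  simp only [Finset.sum_const, Finset.card_range, nsmul_eq_mul, mul_one] at h4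
  rw [Finset.sum_range_succ, Finset.sum_range_add (fun i => (3 / 4 : ℝ) ^ i) (max e 1) j]
  have h5 : 0 ≤ p.batchRate * (N / p.Llow) := by positivity
  nlinarith [mul_le_mul_of_nonneg_left h3 h5]

/-- If the noise is small along all forced runs with few additional passes, then the method follows
one of them, each of its tests is passed, and the number of samples is bounded. -/
theorem exists_run_eq_forcedRun {L : ℝ} (hf : HasLipschitzGradient f L) (hp : p.Valid j₀)
    (hL : L ≤ p.Lbar) {w : ℕ → ℕ → ℕ → Ξ}
    (hw : ∀ pass : ℕ → ℕ, ∑ i ∈ Finset.range p.N, pass i ≤ p.m → ∀ k < p.N,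
      ‖forcedNoise f G p x₀ pass (fun i => w i (pass i)) k‖ ^ 2 ≤ p.ε / (2 * p.weight pass k)) :
    ∀ k ≤ p.N, ∃ pass : ℕ → ℕ, (∀ i, k ≤ i → pass i = 0) ∧
      run f G p x₀ w k = some (forcedRun G p x₀ pass (fun i => w i (pass i)) k) ∧
      ∑ i ∈ Finset.range k, pass i ≤ p.exponentSeq j₀ pass k ∧
      (∀ i < k, Accept f G p (forcedRun G p x₀ pass (fun i => w i (pass i)) i)
        (p.constSeq pass (i + 1)) (w i (pass i))) ∧
      ((forcedRun G p x₀ pass (fun i => w i (pass i)) k).calls : ℝ)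
        ≤ p.batchRate * (p.weightSum pass k
          + p.N / p.Llow * ∑ i ∈ Finset.range (p.exponentSeq j₀ pass k), (3 / 4 : ℝ) ^ i)
          + k + p.exponentSeq j₀ pass k := by
  classical
  intro k hk
  induction k with
  | zero =>
    refine ⟨fun _ => 0, fun _ _ => rfl, rfl, by simp, by simp, ?_⟩
    have := hp.batchRate_pos
    have := hp.Llow_pos
    have h0 : ∀ pass, p.weightSum pass 0 = 0 := fun _ => rfl
    rw [h0]
    simp only [forcedRun, Nat.cast_zero]
    positivity
  | succ k ih =>
    obtain ⟨pass, h0, hrun, hsum, hacc, hcalls⟩ := ih (by omega)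
    set s := forcedRun G p x₀ pass (fun i => w i (pass i)) k with hs
    set e := p.exponentSeq j₀ pass k with he
    have hem : max e 1 ≤ p.m := max_le (hp.exponentSeq_le k) hp.one_le_m
    have hsL : s.L = p.constSeq pass k := forcedRun_L k
    have hsA : s.A = p.weightSum pass k := forcedRun_A k
    have hsL' : s.L = 2 ^ e * p.Llow := hsL.trans (hp.constSeq_eq k)
    have hlt : ∀ j, ∀ i < k, Function.update pass k j i = pass i := fun j i hi =>
      Function.update_of_ne hi.ne _ _
    have hself : ∀ j, Function.update pass k j k = j := fun j => Function.update_self ..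
    have hrunj : ∀ j, forcedRun G p x₀ (Function.update pass k j)
        (fun i => w i (Function.update pass k j i)) k = s := fun j =>
      forcedRun_congr (hlt j) fun i hi => by rw [hlt j i hi]
    have hcj : ∀ j, p.constSeq (Function.update pass k j) (k + 1) = p.trialL s.L j := fun j => by
      rw [Params.constSeq, hself, Params.constSeq_congr (hlt j), hsL]
    have hAj : ∀ j, p.weightSum (Function.update pass k j) k = s.A := fun j => by
      rw [Params.weightSum_congr (hlt j), hsA]
    have hej : ∀ j, max e 1 + j ≤ p.m →
        p.exponentSeq j₀ (Function.update pass k j) (k + 1) = max e 1 + j := fun j hj => by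
      rw [Params.exponentSeq, hself, Params.exponentSeq_congr (hlt j), min_eq_left hj]
    have hsumj : ∀ j, ∑ i ∈ Finset.range (k + 1), Function.update pass k j i
        = ∑ i ∈ Finset.range k, pass i + j := fun j => by
      rw [Finset.sum_range_succ, hself,
        Finset.sum_congr rfl fun i hi => hlt j i (Finset.mem_range.1 hi)]
    have hzero : ∀ j i, k + 1 ≤ i → Function.update pass k j i = 0 := fun j i hi => by
      rw [Function.update_of_ne (by omega), h0 i (by omega)]
    -- After `m - max e 1` rejections the trial constant is `L̄ ≥ L`. Keeping that pass brings the
    -- total of additional passes to at most `e + (m - max e 1) ≤ m`, so the noise hypothesis covers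
    -- this forced run.
    have hlast : Accept f G p s (p.trialL s.L (p.m - max e 1)) (w k (p.m - max e 1)) := by
      set j := p.m - max e 1 with hj
      have hLj : p.trialL s.L j = p.Lbar := by
        rw [hsL', hp.trialL_two_pow, hp.Lbar_eq]
        congr 2
        omega
      have hnoise := hw (Function.update pass k j) ?_ k (by omega)
      · rw [hLj]
        refine accept_of_norm_trialNoise_le hf hp.Lbar_pos hL
          (by rw [hsA]; exact hp.weightSum_nonneg k) ?_
        unfold forcedNoise Params.weight at hnoise
        rw [hrunj, hcj, hAj] at hnoise
        beta_reduce at hnoise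
        rwa [hself, hLj] at hnoise
      · rw [← Finset.sum_subset (Finset.range_mono (show k + 1 ≤ p.N by omega))
          fun i _ hi => hzero j i (by simpa using hi), hsumj]
        omega
    have hex : ∃ j, Accept f G p s (p.trialL s.L j) (w k j) := ⟨_, hlast⟩
    -- Consequently the cap at `m` does not act before the accepted pass, and every rejection raises
    -- the exponent by exactly one.
    have hfind : Nat.find hex ≤ p.m - max e 1 := Nat.find_min' hex hlast
    have hfacc := Nat.find_spec hex
    have hiter := iterate_eq_passState hex
    set j := Nat.find hex
    have hjm : max e 1 + j ≤ p.m := by omega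
    have hnew : forcedRun G p x₀ (Function.update pass k j)
        (fun i => w i (Function.update pass k j i)) (k + 1) = passState G p s j (w k j) := by
      rw [forcedRun, hrunj, hself]
    refine ⟨Function.update pass k j, hzero j, ?_, ?_, ?_, ?_⟩
    · rw [hnew, ← hiter, run, hrun]
      rfl
    · rw [hsumj, hej j hjm]
      omega
    · intro i hi
      rcases Nat.lt_succ_iff_lt_or_eq.1 hi with hi | rfl
      · rw [forcedRun_congr (fun l hl => hlt j l (hl.trans hi))
            (z' := fun i => w i (pass i)) fun l hl => by rw [hlt j l (hl.trans hi)],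
          Params.constSeq_congr (pass' := pass) fun l hl => hlt j l (by omega), hlt j i hi]
        exact hacc i hi
      · rw [hrunj, hcj, hself]
        exact hfacc
    · rw [hnew, hej j hjm, Params.weightSum, hcj, hAj]
      have hN : (1 : ℝ) ≤ p.N := by exact_mod_cast one_le_two.trans hp.two_le_N
      have hA : s.A ≤ (p.N : ℝ) ^ 2 / (2 * p.Llow) := by
        rw [hsA]
        refine (hp.weightSum_mono (show k ≤ p.N by omega)).trans (hp.weightSum_le _)
      have hb := sum_trialBatch_le hp hN hA hsL' hjm
      rw [← hsA] at hcalls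
      have he1 : (e : ℝ) ≤ max (e : ℝ) 1 := le_max_left _ _
      simp only [passState]
      push_cast at hb ⊢
      linarith

end ForcedRun

/-! ### Tail bounds for the noise along one forced run. -/

section Concentration

theorem measure_lt_le_of_lintegral_exp_le {Ω : Type*} [MeasurableSpace Ω] {P : Measure Ω}
    {X : Ω → ℝ} (hX : Measurable X) {c B : ℝ} (hc : 0 ≤ c)
    (h : ∫⁻ ω, ENNReal.ofReal (Real.exp (c * X ω)) ∂P ≤ ENNReal.ofReal (Real.exp B)) (t : ℝ) :
    P {ω | t < X ω} ≤ ENNReal.ofReal (Real.exp (B - c * t)) := by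
  have h1 : {ω | t < X ω}
      ⊆ {ω | ENNReal.ofReal (Real.exp (c * t)) ≤ ENNReal.ofReal (Real.exp (c * X ω))} := by
    intro ω (hω : t < X ω)
    refine ENNReal.ofReal_le_ofReal (Real.exp_le_exp.2 ?_)
    gcongr
  refine (measure_mono h1).trans ?_
  refine (meas_ge_le_lintegral_div (by fun_prop) ?_ ENNReal.ofReal_ne_top).trans ?_
  · exact (ENNReal.ofReal_pos.2 (Real.exp_pos _)).ne'
  · rw [Real.exp_sub, ENNReal.ofReal_div_of_pos (Real.exp_pos _)]
    gcongr

variable {n : ℕ} {Ω Ξ : Type*} [MeasurableSpace Ω] [MeasurableSpace Ξ]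
  {P : Measure Ω} [IsProbabilityMeasure P] {ν : Measure Ξ}
  {f : Vec n → ℝ} {G : Vec n → Ξ → Vec n} {σ : ℝ}

theorem miniBatch_sub_eq {r : ℕ} (hr : 1 ≤ r) (z : ℕ → Ξ) (x c : Vec n) :
    miniBatch G r z x - c = (r : ℝ)⁻¹ • ∑ l ∈ Finset.range r, (G x (z l) - c) := by
  have : (r : ℝ) ≠ 0 := by positivity
  unfold miniBatch
  rw [Finset.sum_sub_distrib, smul_sub, Finset.sum_const, Finset.card_range,
    ← Nat.cast_smul_eq_nsmul ℝ, inv_smul_smul₀ this]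

theorem iIndepFun_oracle_sub {ζ : ℕ → Ω → Ξ} (hG : IsSubGaussianOracle f G ν σ)
    (hind : iIndepFun ζ P) (x : Vec n) : iIndepFun (fun l ω => G x (ζ l ω) - ∇ f x) P :=
  hind.comp (fun _ ξ => G x ξ - ∇ f x)
    fun _ => (hG.measurable.comp measurable_prodMk_left).sub_const _

theorem lintegral_exp_inner_miniBatch_le {ζ : ℕ → Ω → Ξ} (hG : IsSubGaussianOracle f G ν σ)
    (hσ : 0 < σ) (hζ : ∀ l, Measurable (ζ l)) (hν : ∀ l, P.map (ζ l) = ν) (hind : iIndepFun ζ P)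
    {r : ℕ} (hr : 1 ≤ r) (x v : Vec n) :
    ∫⁻ ω, ENNReal.ofReal (Real.exp ⟪miniBatch G r (fun l => ζ l ω) x - ∇ f x, v⟫_ℝ) ∂P
        ≤ ENNReal.ofReal (Real.exp (2 * ‖v‖ ^ 2 * σ ^ 2 / r)) ∧
    ∫⁻ ω, ENNReal.ofReal (Real.exp (r / (32 * σ ^ 2)
          * ‖miniBatch G r (fun l => ζ l ω) x - ∇ f x‖ ^ 2)) ∂P
        ≤ ENNReal.ofReal (Real.exp 1) := by
  have hGx : Measurable (G x) := hG.measurable.comp measurable_prodMk_left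
  have hm : ∀ l, Measurable fun ω => G x (ζ l ω) - ∇ f x := fun l =>
    (hGx.comp (hζ l)).sub_const _
  have hν' : IsProbabilityMeasure ν := hν 0 ▸ Measure.isProbabilityMeasure_map (hζ 0).aemeasurable
  have hGi : ∀ l, Integrable (fun ω => G x (ζ l ω)) P := fun l => by
    have := hG.integrable x
    rw [← hν l] at this
    exact this.comp_measurable (hζ l)
  have hi : ∀ l, Integrable (fun ω => G x (ζ l ω) - ∇ f x) P := fun l =>
    (hGi l).sub (integrable_const _)
  have h0 : ∀ l, ∫ ω, (G x (ζ l ω) - ∇ f x) ∂P = 0 := fun l => by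
    rw [integral_sub (hGi l) (integrable_const _), integral_const, probReal_univ, one_smul,
      ← integral_map (hζ l).aemeasurable (f := G x) hGx.aestronglyMeasurable, hν l, hG.unbiased,
      sub_self]
  have ht : ∀ l, ∫⁻ ω, ENNReal.ofReal (Real.exp (‖G x (ζ l ω) - ∇ f x‖ ^ 2 / σ ^ 2)) ∂P
      ≤ ENNReal.ofReal (Real.exp 1) := fun l => by
    rw [← lintegral_map (f := fun ξ => ENNReal.ofReal (Real.exp (‖G x ξ - ∇ f x‖ ^ 2 / σ ^ 2)))
      (by fun_prop) (hζ l), hν l]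
    exact hG.light_tail x
  have hr' : (0 : ℝ) < r := by exact_mod_cast hr
  constructor
  · have := lintegral_exp_inner_sum_le hm (iIndepFun_oracle_sub hG hind x) hi h0 ht hσ ((r : ℝ)⁻¹ • v) r
    refine (le_of_eq (lintegral_congr fun ω => ?_)).trans (this.trans (le_of_eq ?_))
    · rw [miniBatch_sub_eq hr, real_inner_smul_left, real_inner_smul_left, real_inner_comm]
    · rw [norm_smul, Real.norm_of_nonneg (by positivity)]
      congr 2
      field_simp
  · have := lintegral_exp_norm_sq_sum_le hm (iIndepFun_oracle_sub hG hind x) hi h0 ht hσ hr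
    refine (le_of_eq (lintegral_congr fun ω => ?_)).trans this
    rw [miniBatch_sub_eq hr, norm_smul, Real.norm_of_nonneg (by positivity)]
    congr 2
    field_simp

theorem measurable_miniBatch {α : Type*} [MeasurableSpace α]
    (hG : Measurable (Function.uncurry G)) (r : ℕ) {z : α → ℕ → Ξ} (hz : Measurable z)
    {y : α → Vec n} (hy : Measurable y) : Measurable fun a => miniBatch G r (z a) (y a) := by
  unfold miniBatch
  have h : ∀ l, Measurable fun a => G (y a) (z a l) := fun l =>
    hG.comp (hy.prodMk ((measurable_pi_apply l).comp hz))
  fun_prop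

theorem measurable_clip (D : ℝ) : Measurable (clip D : Vec n → Vec n) :=
  Measurable.ite (measurableSet_le measurable_norm measurable_const) measurable_id measurable_const

theorem HasLipschitzGradient.measurable_gradient {L : ℝ} (h : HasLipschitzGradient f L) :
    Measurable (∇ f) := by
  have h1 : Continuous (fderiv ℝ f) := h.1.continuous_fderiv one_ne_zero
  exact ((InnerProductSpace.toDual ℝ (Vec n)).symm.continuous.comp h1).measurable

variable (f G) in
/-- One iteration of the forced run, acting on the iterates `x`, `u` and the accumulated noise. -/
def forcedStep (p : Params) (v : Vec n) (D : ℝ) (pass : ℕ → ℕ) (k : ℕ)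
    (q : Vec n × Vec n × ℝ) (z : ℕ → Ξ) : Vec n × Vec n × ℝ :=
  let s : State n := ⟨p.weightSum pass k, p.constSeq pass k, q.1, q.2.1, 0⟩
  let L := p.constSeq pass (k + 1)
  (trialX G p s L z, trialU G p s L z,
    q.2.2 + p.weight pass k * ⟪trialNoise f G p s L z, clip D (v - q.2.1)⟫_ℝ)

theorem measurable_trialGrad (hG : Measurable (Function.uncurry G)) (p : Params) (A l L : ℝ) :
    Measurable fun a : (Vec n × Vec n × ℝ) × (ℕ → Ξ) =>
      trialGrad G p ⟨A, l, a.1.1, a.1.2.1, 0⟩ L a.2 := by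
  unfold trialGrad
  refine measurable_miniBatch hG (p.batchSize (stepWeight A L)) measurable_snd ?_
  unfold trialY
  dsimp only
  fun_prop

theorem measurable_trialNoise (hG : Measurable (Function.uncurry G)) (hf : Measurable (∇ f))
    (p : Params) (A l L : ℝ) :
    Measurable fun a : (Vec n × Vec n × ℝ) × (ℕ → Ξ) =>
      trialNoise f G p ⟨A, l, a.1.1, a.1.2.1, 0⟩ L a.2 := by
  unfold trialNoise
  refine (measurable_trialGrad hG p A l L).sub (hf.comp ?_)
  unfold trialY
  dsimp only
  fun_prop

theorem measurable_forcedStep (hG : Measurable (Function.uncurry G)) (hf : Measurable (∇ f))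
    (p : Params) (v : Vec n) (D : ℝ) (pass : ℕ → ℕ) (k : ℕ) :
    Measurable (Function.uncurry (forcedStep f G p v D pass k)) := by
  have h1 := measurable_trialGrad hG p (p.weightSum pass k) (p.constSeq pass k)
    (p.constSeq pass (k + 1))
  have h2 := measurable_trialNoise hG hf p (p.weightSum pass k) (p.constSeq pass k)
    (p.constSeq pass (k + 1))
  have h3 : Measurable fun a : (Vec n × Vec n × ℝ) × (ℕ → Ξ) => clip D (v - a.1.2.1) :=
    (measurable_clip D).comp (by fun_prop)
  unfold Function.uncurry forcedStep trialX trialU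
  dsimp only
  fun_prop

variable (f G) in
/-- The iterates of the forced run together with the accumulated noise. -/
def forcedState (p : Params) (x₀ v : Vec n) (D : ℝ) (pass : ℕ → ℕ) (z : ℕ → ℕ → Ξ) (k : ℕ) :
    Vec n × Vec n × ℝ :=
  ((forcedRun G p x₀ pass z k).x, (forcedRun G p x₀ pass z k).u, noiseSum f G p x₀ v D pass z k)

variable {p : Params} {x₀ v : Vec n} {D : ℝ} {pass : ℕ → ℕ} {j₀ : ℕ}

theorem forcedNoise_eq (z : ℕ → ℕ → Ξ) (k : ℕ) :
    forcedNoise f G p x₀ pass z k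
      = trialNoise f G p ⟨p.weightSum pass k, p.constSeq pass k,
          (forcedState f G p x₀ v D pass z k).1, (forcedState f G p x₀ v D pass z k).2.1, 0⟩
          (p.constSeq pass (k + 1)) (z k) := by
  rw [← forcedRun_A (G := G) (x₀ := x₀) (z := z)]
  rfl

theorem forcedState_succ (z : ℕ → ℕ → Ξ) (k : ℕ) :
    forcedState f G p x₀ v D pass z (k + 1)
      = forcedStep f G p v D pass k (forcedState f G p x₀ v D pass z k) (z k) := by
  have h1 : (forcedState f G p x₀ v D pass z (k + 1)).2.2
      = (forcedState f G p x₀ v D pass z k).2.2 + p.weight pass k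
        * ⟪forcedNoise f G p x₀ pass z k, clip D (v - (forcedRun G p x₀ pass z k).u)⟫_ℝ :=
    Finset.sum_range_succ _ _
  refine Prod.ext ?_ (Prod.ext ?_ ?_)
  · unfold forcedStep
    rw [Params.constSeq, ← forcedRun_A (G := G) (x₀ := x₀) (z := z),
      ← forcedRun_L (G := G) (x₀ := x₀) (z := z)]
    rfl
  · unfold forcedStep
    rw [Params.constSeq, ← forcedRun_A (G := G) (x₀ := x₀) (z := z),
      ← forcedRun_L (G := G) (x₀ := x₀) (z := z)]
    rfl
  · rw [h1, forcedNoise_eq (v := v) (D := D)]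
    rfl

/-- Independent samples with the law `ν`, arranged in one block for each iteration. -/
structure IsSampleArray (P : Measure Ω) (ν : Measure Ξ) (ζ : ℕ × ℕ → Ω → Ξ) : Prop where
  measurable : ∀ i, Measurable (ζ i)
  map_eq : ∀ i, P.map (ζ i) = ν
  indep : iIndepFun ζ P

variable {ζ : ℕ × ℕ → Ω → Ξ} {L : ℝ}

theorem IsSampleArray.indepFun_forcedState (hζ : IsSampleArray P ν ζ)
    (hG : IsSubGaussianOracle f G ν σ) (hf : HasLipschitzGradient f L) (k : ℕ) :
    Measurable (fun ω => forcedState f G p x₀ v D pass (fun i l => ζ (i, l) ω) k) ∧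
    IndepFun (fun ω => forcedState f G p x₀ v D pass (fun i l => ζ (i, l) ω) k)
      (fun ω l => ζ (k, l) ω) P :=
  indepFun_recursion hζ.measurable hζ.indep
    (X := fun k ω => forcedState f G p x₀ v D pass (fun i l => ζ (i, l) ω) k)
    (measurable_forcedStep hG.measurable hf.measurable_gradient p v D pass) (x₀, x₀, 0)
    (fun _ => rfl) (fun k _ => forcedState_succ _ k) k

theorem IsSampleArray.lintegral_exp_block_le (hζ : IsSampleArray P ν ζ)
    (hG : IsSubGaussianOracle f G ν σ) (hσ : 0 < σ) (k : ℕ) {r : ℕ} (hr : 1 ≤ r) (x v : Vec n) :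
    ∫⁻ ω, ENNReal.ofReal (Real.exp ⟪miniBatch G r (fun l => ζ (k, l) ω) x - ∇ f x, v⟫_ℝ) ∂P
        ≤ ENNReal.ofReal (Real.exp (2 * ‖v‖ ^ 2 * σ ^ 2 / r)) ∧
    ∫⁻ ω, ENNReal.ofReal (Real.exp (r / (32 * σ ^ 2)
          * ‖miniBatch G r (fun l => ζ (k, l) ω) x - ∇ f x‖ ^ 2)) ∂P
        ≤ ENNReal.ofReal (Real.exp 1) :=
  lintegral_exp_inner_miniBatch_le hG hσ (fun l => hζ.measurable (k, l))
    (fun l => hζ.map_eq (k, l)) (hζ.indep.precomp (g := fun l => (k, l)) (Prod.mk_right_injective k))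
    hr x v

/-- The batch size is at least `batchRate` times the weight, while the threshold is inversely
proportional to the weight; the weight cancels and the bound is uniform in `k` and `pass`. -/
theorem IsSampleArray.measure_norm_forcedNoise_le (hζ : IsSampleArray P ν ζ)
    (hG : IsSubGaussianOracle f G ν σ) (hf : HasLipschitzGradient f L) (hp : p.Valid j₀)
    (hσ : 0 < σ) (k : ℕ) :
    P {ω | p.ε / (2 * p.weight pass k)
        < ‖forcedNoise f G p x₀ pass (fun i l => ζ (i, l) ω) k‖ ^ 2}
      ≤ ENNReal.ofReal (Real.exp (1 - p.batchRate * p.ε / (64 * σ ^ 2))) := by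
  -- The reference point `x₀` and radius `0` are arbitrary: only the iterates of the state are
  -- needed, not its accumulated noise.
  obtain ⟨hm, hi⟩ := hζ.indepFun_forcedState (p := p) (x₀ := x₀) (v := x₀) (D := 0) (pass := pass)
    hG hf k
  have hmb : Measurable fun ω l => ζ (k, l) ω := measurable_pi_lambda _ fun l => hζ.measurable _
  have hmt := measurable_trialNoise hG.measurable hf.measurable_gradient p (p.weightSum pass k)
    (p.constSeq pass k) (p.constSeq pass (k + 1))
  set r := p.batchSize (p.weight pass k) with hr
  have hr1 : 1 ≤ r := p.one_le_batchSize _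
  have hint := lintegral_le_of_indepFun (P := P) hm hmb hi
    (F := fun q z => ENNReal.ofReal (Real.exp (r / (32 * σ ^ 2)
      * ‖trialNoise f G p ⟨p.weightSum pass k, p.constSeq pass k, q.1, q.2.1, 0⟩
          (p.constSeq pass (k + 1)) z‖ ^ 2)))
    (c := fun _ => ENNReal.ofReal (Real.exp 1))
    (by unfold Function.uncurry; fun_prop) measurable_const
    (fun q => (hζ.lintegral_exp_block_le hG hσ k hr1 _ 0).2)
  rw [lintegral_const, measure_univ, mul_one] at hint
  simp_rw [← forcedNoise_eq (f := f) (G := G) (v := x₀) (D := 0)] at hint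
  have hmn : Measurable fun ω => forcedNoise f G p x₀ pass (fun i l => ζ (i, l) ω) k := by
    rw [show (fun ω => forcedNoise f G p x₀ pass (fun i l => ζ (i, l) ω) k) = _ from
      funext fun ω => forcedNoise_eq (v := x₀) (D := 0) _ k]
    have h := hmt.comp (hm.prodMk hmb)
    unfold Function.comp at h
    exact h
  refine (measure_lt_le_of_lintegral_exp_le (hmn.norm.pow_const 2) (by positivity) hint _).trans ?_
  refine ENNReal.ofReal_le_ofReal (Real.exp_le_exp.2 (sub_le_sub_left ?_ _))
  have hw := hp.weight_pos (pass := pass) k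
  have hε := hp.ε_pos
  calc p.batchRate * p.ε / (64 * σ ^ 2)
      = (p.batchRate * p.weight pass k) * (p.ε / (64 * σ ^ 2 * p.weight pass k)) := by
        field_simp
    _ ≤ r * (p.ε / (64 * σ ^ 2 * p.weight pass k)) := by
        gcongr
        exact p.batchRate_mul_le _
    _ = _ := by field_simp; norm_num

/-- Chernoff's bound for an exponential supermartingale. The clipped direction depends on the past
only and has norm at most `D`. A step of weight `a` costs `2θ²a²D²σ² / r`; as `r ≥ batchRate * a`,
one factor `a` cancels and the costs add up to a multiple of the sum of weights. -/
theorem IsSampleArray.measure_noiseSum_le (hζ : IsSampleArray P ν ζ)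
    (hG : IsSubGaussianOracle f G ν σ) (hf : HasLipschitzGradient f L) (hp : p.Valid j₀)
    (hσ : 0 < σ) (hD : 0 ≤ D) (k : ℕ) {θ : ℝ} (hθ : 0 ≤ θ) (t : ℝ) :
    P {ω | t < noiseSum f G p x₀ v D pass (fun i l => ζ (i, l) ω) k}
      ≤ ENNReal.ofReal (Real.exp
          (2 * θ ^ 2 * D ^ 2 * σ ^ 2 * p.weightSum pass k / p.batchRate - θ * t)) := by
  have hm := fun k => hζ.indepFun_forcedState (p := p) (x₀ := x₀) (v := v) (D := D) (pass := pass)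
    hG hf k
  have hB := hp.batchRate_pos
  have hkey := lintegral_potential_le (P := P)
    (X := fun k ω => forcedState f G p x₀ v D pass (fun i l => ζ (i, l) ω) k)
    (Y := fun k ω l => ζ (k, l) ω) (step := forcedStep f G p v D pass)
    (fun k => (hm k).1) (fun k => measurable_pi_lambda _ fun l => hζ.measurable _)
    (fun k => (hm k).2)
    (measurable_forcedStep hG.measurable hf.measurable_gradient p v D pass)
    (fun k ω => forcedState_succ _ k)
    (W := fun k q => ENNReal.ofReal (Real.exp
      (θ * q.2.2 - 2 * θ ^ 2 * D ^ 2 * σ ^ 2 * p.weightSum pass k / p.batchRate)))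
    (fun k => by fun_prop) (r := k) ?_ k le_rfl
  · have h0 : ∫⁻ ω, ENNReal.ofReal (Real.exp
        (θ * (forcedState f G p x₀ v D pass (fun i l => ζ (i, l) ω) 0).2.2
          - 2 * θ ^ 2 * D ^ 2 * σ ^ 2 * p.weightSum pass 0 / p.batchRate)) ∂P = 1 := by
      simp [forcedState, noiseSum, Params.weightSum]
    rw [h0] at hkey
    refine measure_lt_le_of_lintegral_exp_le (hm k).1.snd.snd hθ ?_ t
    calc _ = ∫⁻ ω, ENNReal.ofReal
            (Real.exp (2 * θ ^ 2 * D ^ 2 * σ ^ 2 * p.weightSum pass k / p.batchRate))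
          * ENNReal.ofReal (Real.exp
            (θ * (forcedState f G p x₀ v D pass (fun i l => ζ (i, l) ω) k).2.2
              - 2 * θ ^ 2 * D ^ 2 * σ ^ 2 * p.weightSum pass k / p.batchRate)) ∂P := by
          refine lintegral_congr fun ω => ?_
          rw [← ENNReal.ofReal_mul (Real.exp_pos _).le, ← Real.exp_add]
          congr 2
          ring
      _ = _ := lintegral_const_mul' _ _ ENNReal.ofReal_ne_top
      _ ≤ _ := mul_le_of_le_one_right' hkey
  · intro i _ q
    set s : State n := ⟨p.weightSum pass i, p.constSeq pass i, q.1, q.2.1, 0⟩ with hs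
    set r := p.batchSize (p.weight pass i) with hr
    have hr1 : 1 ≤ r := p.one_le_batchSize _
    have hr0 : (0 : ℝ) < r := by exact_mod_cast hr1
    have hw := hp.weight_pos (pass := pass) i
    have hblock := (hζ.lintegral_exp_block_le hG hσ i hr1 (trialY s (p.constSeq pass (i + 1)))
      ((θ * p.weight pass i) • clip D (v - q.2.1))).1
    calc _ = ∫⁻ ω, ENNReal.ofReal (Real.exp
            (θ * q.2.2 - 2 * θ ^ 2 * D ^ 2 * σ ^ 2 * p.weightSum pass (i + 1) / p.batchRate))
          * ENNReal.ofReal (Real.exp ⟪miniBatch G r (fun l => ζ (i, l) ω)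
              (trialY s (p.constSeq pass (i + 1))) - ∇ f (trialY s (p.constSeq pass (i + 1))),
            (θ * p.weight pass i) • clip D (v - q.2.1)⟫_ℝ) ∂P := by
          refine lintegral_congr fun ω => ?_
          rw [← ENNReal.ofReal_mul (Real.exp_pos _).le, ← Real.exp_add, real_inner_smul_right]
          congr 2
          change θ * (q.2.2 + p.weight pass i * ⟪miniBatch G r (fun l => ζ (i, l) ω)
              (trialY s (p.constSeq pass (i + 1))) - ∇ f (trialY s (p.constSeq pass (i + 1))),
              clip D (v - q.2.1)⟫_ℝ) - _ = _
          ring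
      _ = _ := lintegral_const_mul' _ _ ENNReal.ofReal_ne_top
      _ ≤ _ := by
          grw [hblock]
          rw [← ENNReal.ofReal_mul (Real.exp_pos _).le, ← Real.exp_add]
          refine ENNReal.ofReal_le_ofReal (Real.exp_le_exp.2 ?_)
          rw [norm_smul, Real.norm_of_nonneg (by positivity), Params.weightSum_succ]
          have h1 : 2 * (θ * p.weight pass i * ‖clip D (v - q.2.1)‖) ^ 2 * σ ^ 2 / r
              ≤ 2 * (θ * p.weight pass i * D) ^ 2 * σ ^ 2 / (p.batchRate * p.weight pass i) := by
            have := norm_clip_le hD (v - q.2.1)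
            have := p.batchRate_mul_le (p.weight pass i)
            gcongr
          have h2 : 2 * (θ * p.weight pass i * D) ^ 2 * σ ^ 2 / (p.batchRate * p.weight pass i)
              = 2 * θ ^ 2 * D ^ 2 * σ ^ 2 * p.weight pass i / p.batchRate := by
            field_simp
          rw [h2] at h1
          rw [mul_add, add_div]
          linarith

end Concentration

/-! ### Dependence on finitely many pass choices; the bad events. -/

section Events

variable {n : ℕ} {Ω Ξ : Type*} {f : Vec n → ℝ} {G : Vec n → Ξ → Vec n} {p : Params} {x₀ v : Vec n}
  {D : ℝ}

theorem forcedNoise_congr {pass pass' : ℕ → ℕ} {z z' : ℕ → ℕ → Ξ} {k : ℕ}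
    (hp : ∀ i ≤ k, pass i = pass' i) (hz : ∀ i ≤ k, z i = z' i) :
    forcedNoise f G p x₀ pass z k = forcedNoise f G p x₀ pass' z' k := by
  unfold forcedNoise
  rw [forcedRun_congr (fun i hi => hp i hi.le) (fun i hi => hz i hi.le), hz k le_rfl,
    Params.constSeq_congr fun i hi => hp i (by omega)]

theorem Params.weight_congr {pass pass' : ℕ → ℕ} {k : ℕ} (hp : ∀ i ≤ k, pass i = pass' i) :
    p.weight pass k = p.weight pass' k := by
  unfold weight
  rw [weightSum_congr fun i hi => hp i hi.le, constSeq_congr fun i hi => hp i (by omega)]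

theorem noiseSum_congr {pass pass' : ℕ → ℕ} {z z' : ℕ → ℕ → Ξ} {k : ℕ}
    (hp : ∀ i < k, pass i = pass' i) (hz : ∀ i < k, z i = z' i) :
    noiseSum f G p x₀ v D pass z k = noiseSum f G p x₀ v D pass' z' k := by
  unfold noiseSum
  refine Finset.sum_congr rfl fun i hi => ?_
  have hi := Finset.mem_range.1 hi
  rw [Params.weight_congr fun l hl => hp l (by omega),
    forcedNoise_congr (fun l hl => hp l (by omega)) fun l hl => hz l (by omega),
    forcedRun_congr (fun l hl => hp l (by omega)) fun l hl => hz l (by omega)]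

variable (f G p x₀ v D) in
/-- The event that the noise in iteration `k`, or the noise accumulated up to it, is large along the
forced run of `pass`. -/
def badEvent (ξ : ℕ → ℕ → ℕ → Ω → Ξ) (pass : ℕ → ℕ) (k : ℕ) : Set Ω :=
  {ω | p.ε / (2 * p.weight pass k)
      < ‖forcedNoise f G p x₀ pass (fun i l => ξ i (pass i) l ω) k‖ ^ 2} ∪
  {ω | ‖x₀ - v‖ ^ 2
      < noiseSum f G p x₀ v D pass (fun i l => ξ i (pass i) l ω) (k + 1)}

end Events

/-! ### Counting the forced runs and bounding each bad event. -/

section UnionBound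

/-- The numbers of additional passes in the iterations `0, …, N - 1` when the `i`-th additional pass
takes place in iteration `c i` (in none, if `c i = N`). -/
def passCount {m N : ℕ} (c : Fin m → Fin (N + 1)) (k : ℕ) : ℕ :=
  ∑ i, if (c i : ℕ) = k then 1 else 0

/-- Assigning an iteration to each of the `m` possible additional passes, with the value `N` for
unused ones, covers all relevant pass sequences by `(N + 1) ^ m` codes. The induction removes one
pass from an iteration that has some. -/
theorem exists_passCount_eq (N m : ℕ) (pass : ℕ → ℕ) (h : ∑ i ∈ Finset.range N, pass i ≤ m) :
    ∃ c : Fin m → Fin (N + 1), ∀ k < N, passCount c k = pass k := by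
  induction m generalizing pass with
  | zero =>
    refine ⟨Fin.elim0, fun k hk => ?_⟩
    have := Finset.sum_eq_zero_iff.1 (Nat.le_zero.1 h) k (Finset.mem_range.2 hk)
    simp [passCount, this]
  | succ m ih =>
    by_cases h0 : ∀ k < N, pass k = 0
    · refine ⟨fun _ => Fin.last N, fun k hk => ?_⟩
      simp [passCount, h0 k hk, hk.ne']
    · push Not at h0
      obtain ⟨k₀, hk₀, hne⟩ := h0
      obtain ⟨c, hc⟩ := ih (Function.update pass k₀ (pass k₀ - 1)) (by
        have h1 := Finset.add_sum_erase (Finset.range N) pass (Finset.mem_range.2 hk₀)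
        have h2 := Finset.add_sum_erase (Finset.range N) (Function.update pass k₀ (pass k₀ - 1))
          (Finset.mem_range.2 hk₀)
        rw [Function.update_self, Finset.sum_congr rfl fun i hi =>
          Function.update_of_ne (Finset.ne_of_mem_erase hi) _ _] at h2
        omega)
      refine ⟨Fin.cons ⟨k₀, by omega⟩ c, fun k hk => ?_⟩
      have := hc k hk
      unfold passCount at this ⊢
      rw [Fin.sum_univ_succ]
      simp only [Fin.cons_zero, Fin.cons_succ, this]
      by_cases hkk : k₀ = k
      · subst hkk
        rw [Function.update_self, if_pos rfl]
        omega
      · rw [Function.update_of_ne (Ne.symm hkk), if_neg hkk, zero_add]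

variable {p : Params} {j₀ : ℕ}

theorem Params.Valid.mul_log_le_logFactor (h : p.Valid j₀) : p.m * Real.log p.N ≤ p.logFactor := by
  have h1 : 0 < Real.log p.α⁻¹ := Real.log_pos ((one_lt_inv₀ h.α_pos).2 h.α_lt_one)
  unfold Params.logFactor
  linarith

theorem Params.Valid.N_le_exp (h : p.Valid j₀) : (p.N : ℝ) ≤ Real.exp p.logFactor := by
  have hN : (0 : ℝ) < p.N := by exact_mod_cast two_pos.trans_le h.two_le_N
  rw [← Real.log_le_iff_le_exp hN]
  refine le_trans ?_ h.mul_log_le_logFactor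
  exact le_mul_of_one_le_left (Real.log_natCast_nonneg _) (by exact_mod_cast h.one_le_m)

theorem Params.Valid.exp_neg_logFactor_le (h : p.Valid j₀) :
    Real.exp (-p.logFactor) ≤ p.α := by
  have h1 : 0 ≤ p.m * Real.log p.N := mul_nonneg (Nat.cast_nonneg _) (Real.log_natCast_nonneg _)
  rw [← Real.le_log_iff_exp_le h.α_pos]
  unfold Params.logFactor
  rw [Real.log_inv]
  linarith

/-- The number of forced runs and of iterations is exponential in `logFactor`. -/
theorem Params.Valid.card_mul_exp_le (h : p.Valid j₀) :
    (p.N + 1 : ℝ) ^ p.m * (p.N * (Real.exp (1 - 7 * p.logFactor) + Real.exp (-(7 * p.logFactor))))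
      ≤ p.α := by
  have hN2 : (2 : ℝ) ≤ p.N := by exact_mod_cast h.two_le_N
  have h1 : (p.N + 1 : ℝ) ^ p.m ≤ Real.exp (2 * p.logFactor) := by
    have h2 : (p.N + 1 : ℝ) ≤ (p.N : ℝ) ^ 2 := by nlinarith
    calc (p.N + 1 : ℝ) ^ p.m ≤ ((p.N : ℝ) ^ 2) ^ p.m := by gcongr
      _ = Real.exp (2 * (p.m * Real.log p.N)) := by
          rw [← Real.exp_log (by positivity : (0 : ℝ) < p.N), Real.log_exp, ← Real.exp_nat_mul,
            ← Real.exp_nat_mul]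
          congr 1
          push_cast
          ring
      _ ≤ _ := Real.exp_le_exp.2 (by linarith [h.mul_log_le_logFactor])
  have h3 := h.N_le_exp
  have h4 : Real.exp 1 + 1 ≤ Real.exp (2 * p.logFactor) := by
    have : Real.exp (2 * p.logFactor) = Real.exp p.logFactor ^ 2 := by
      rw [← Real.exp_nat_mul]; norm_num
    rw [this]
    nlinarith [Real.exp_one_lt_d9]
  have h5 : Real.exp (1 - 7 * p.logFactor) + Real.exp (-(7 * p.logFactor))
      = (Real.exp 1 + 1) * Real.exp (-(7 * p.logFactor)) := by
    rw [sub_eq_add_neg, Real.exp_add]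
    ring
  rw [h5]
  -- Of the exponent `7`, the number of runs uses `2`, the number of iterations `1`, the factor `e +
  -- 1` another `2`; what remains is more than the `1` needed for `α`.
  calc _ ≤ Real.exp (2 * p.logFactor) * (Real.exp p.logFactor
          * (Real.exp (2 * p.logFactor) * Real.exp (-(7 * p.logFactor)))) := by gcongr
    _ = Real.exp (-(2 * p.logFactor)) := by
        rw [← Real.exp_add, ← Real.exp_add, ← Real.exp_add]
        congr 1
        ring
    _ ≤ Real.exp (-p.logFactor) := Real.exp_le_exp.2 (by linarith [h.logFactor_pos])
    _ ≤ _ := h.exp_neg_logFactor_le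

variable {n : ℕ} {Ω Ξ : Type*} [MeasurableSpace Ω] [MeasurableSpace Ξ]
  {P : Measure Ω} [IsProbabilityMeasure P] {ν : Measure Ξ}
  {f : Vec n → ℝ} {G : Vec n → Ξ → Vec n} {σ L : ℝ} {x₀ v : Vec n} {D : ℝ}

theorem measure_badEvent_le {ξ : ℕ → ℕ → ℕ → Ω → Ξ} {pass : ℕ → ℕ}
    (hζ : IsSampleArray P ν fun i : ℕ × ℕ => ξ i.1 (pass i.1) i.2)
    (hG : IsSubGaussianOracle f G ν σ) (hf : HasLipschitzGradient f L) (hp : p.Valid j₀)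
    (hσ : 0 < σ) (hD : 0 ≤ D) {k : ℕ} (hk : k < p.N) (hR : 0 < ‖x₀ - v‖)
    (h1 : 7 * p.logFactor ≤ p.batchRate * p.ε / (64 * σ ^ 2))
    (h2 : 56 * p.logFactor * D ^ 2 * σ ^ 2 * p.weightSum pass p.N
      ≤ p.batchRate * ‖x₀ - v‖ ^ 4) :
    P (badEvent f G p x₀ v D ξ pass k)
      ≤ ENNReal.ofReal (Real.exp (1 - 7 * p.logFactor) + Real.exp (-(7 * p.logFactor))) := by
  have hl := hp.logFactor_pos
  have hB := hp.batchRate_pos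
  rw [ENNReal.ofReal_add (Real.exp_pos _).le (Real.exp_pos _).le]
  refine (measure_union_le _ _).trans (add_le_add ?_ ?_)
  · refine (hζ.measure_norm_forcedNoise_le hG hf hp hσ k).trans ?_
    exact ENNReal.ofReal_le_ofReal (Real.exp_le_exp.2 (by linarith))
  -- This `θ` optimizes the Chernoff exponent in the extremal case of `h2`: the linear term is `-14`
  -- and the quadratic one at most `7` times `logFactor`.
  · refine (hζ.measure_noiseSum_le hG hf hp hσ hD (k + 1)
      (θ := 14 * p.logFactor / ‖x₀ - v‖ ^ 2) (by positivity) _).trans ?_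
    refine ENNReal.ofReal_le_ofReal (Real.exp_le_exp.2 ?_)
    have e1 : 14 * p.logFactor / ‖x₀ - v‖ ^ 2 * ‖x₀ - v‖ ^ 2 = 14 * p.logFactor := by field_simp
    have e2 : 2 * (14 * p.logFactor / ‖x₀ - v‖ ^ 2) ^ 2 * D ^ 2 * σ ^ 2 * p.weightSum pass (k + 1)
        / p.batchRate ≤ 7 * p.logFactor := by
      calc _ ≤ 2 * (14 * p.logFactor / ‖x₀ - v‖ ^ 2) ^ 2 * D ^ 2 * σ ^ 2 * p.weightSum pass p.N
            / p.batchRate := by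
            gcongr
            exact hp.weightSum_mono hk
        _ = 7 * p.logFactor * (56 * p.logFactor * D ^ 2 * σ ^ 2 * p.weightSum pass p.N)
            / (p.batchRate * ‖x₀ - v‖ ^ 4) := by
            field_simp
            ring
        _ ≤ 7 * p.logFactor * (p.batchRate * ‖x₀ - v‖ ^ 4) / (p.batchRate * ‖x₀ - v‖ ^ 4) := by
            gcongr
        _ = _ := by field_simp
    rw [e1]
    linarith

end UnionBound

/-! ### The deterministic conclusion off the bad events, and their total probability. -/

section Main

variable {p : Params} {j₀ : ℕ} {n : ℕ} {Ξ : Type*}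
  {f : Vec n → ℝ} {G : Vec n → Ξ → Vec n} {L : ℝ} {x₀ v : Vec n} {D : ℝ}

/-- Outside of the bad events the method stops with a good output after few samples. -/
theorem exists_run_eq_some (hc : ConvexOn ℝ Set.univ f) (hf : HasLipschitzGradient f L)
    (hmin : ∀ x, f v ≤ f x) (hp : p.Valid j₀) (hL : L ≤ p.Lbar) (hD : 0 ≤ D)
    (hDN : ∀ pass, 3 * ‖x₀ - v‖ ^ 2 + p.weightSum pass p.N * p.ε ≤ D ^ 2)
    (hNR : ∀ pass, 3 * ‖x₀ - v‖ ^ 2 ≤ p.weightSum pass p.N * p.ε)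
    {w : ℕ → ℕ → ℕ → Ξ}
    (hw : ∀ c : Fin p.m → Fin (p.N + 1), ∀ k < p.N,
      ‖forcedNoise f G p x₀ (passCount c) (fun i => w i (passCount c i)) k‖ ^ 2
          ≤ p.ε / (2 * p.weight (passCount c) k) ∧
      noiseSum f G p x₀ v D (passCount c) (fun i => w i (passCount c i)) (k + 1)
          ≤ ‖x₀ - v‖ ^ 2) :
    ∃ s : State n, run f G p x₀ w p.N = some s ∧ f s.x - f v ≤ p.ε ∧
      (s.calls : ℝ) ≤ 5 * p.batchRate * p.N ^ 2 / p.Llow + p.N + p.m := by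
  have hw' : ∀ pass : ℕ → ℕ, ∑ i ∈ Finset.range p.N, pass i ≤ p.m → ∀ k < p.N,
      ‖forcedNoise f G p x₀ pass (fun i => w i (pass i)) k‖ ^ 2 ≤ p.ε / (2 * p.weight pass k) ∧
      noiseSum f G p x₀ v D pass (fun i => w i (pass i)) (k + 1) ≤ ‖x₀ - v‖ ^ 2 := by
    intro pass hpass k hk
    obtain ⟨c, hc⟩ := exists_passCount_eq p.N p.m pass hpass
    have hck : ∀ i ≤ k, passCount c i = pass i := fun i hi => hc i (by omega)
    have := hw c k hk
    rwa [forcedNoise_congr (z' := fun i => w i (pass i)) hck fun i hi => by rw [hck i hi],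
      Params.weight_congr hck,
      noiseSum_congr (z' := fun i => w i (pass i)) (fun i hi => hck i (by omega))
        fun i hi => by rw [hck i (by omega)]] at this
  obtain ⟨pass, -, hrun, hsum, hacc, hcalls⟩ := exists_run_eq_forcedRun hf hp hL
    (fun pass hpass k hk => (hw' pass hpass k hk).1) p.N le_rfl
  have hpot := potential_le hc hf.differentiable hmin hp hD (hDN pass) hacc
    (fun k hk => (hw' pass (hsum.trans (hp.exponentSeq_le _)) k hk).2) p.N le_rfl
  have hMN : noiseSum f G p x₀ v D pass (fun i => w i (pass i)) p.N ≤ ‖x₀ - v‖ ^ 2 := by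
    have hN : p.N - 1 < p.N := by have := hp.two_le_N; omega
    have := (hw' pass (hsum.trans (hp.exponentSeq_le _)) (p.N - 1) hN).2
    rwa [Nat.sub_add_cancel (by omega)] at this
  have hl := hp.Llow_pos
  have hB := hp.batchRate_pos
  have hN1 : (1 : ℝ) ≤ p.N := by exact_mod_cast one_le_two.trans hp.two_le_N
  refine ⟨_, hrun, ?_, hcalls.trans ?_⟩
  · have hA : 0 < p.weightSum pass p.N := by
      refine lt_of_lt_of_le ?_ (hp.le_weightSum p.N)
      have := hp.Lbar_pos
      positivity
    -- The potential bound gives `A_N (f(x^N) - f(v)) ≤ 3R²/2 + A_N ε / 2`, and `hNR` says that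
    -- `3R²/2 ≤ A_N ε / 2`.
    refine le_of_mul_le_mul_left ?_ hA
    have := hNR pass
    have := sq_nonneg ‖(forcedRun G p x₀ pass (fun i => w i (pass i)) p.N).u - v‖
    linarith
  · have hgeom : ∑ i ∈ Finset.range (p.exponentSeq j₀ pass p.N), (3 / 4 : ℝ) ^ i ≤ 4 := by
      rw [geom_sum_eq (by norm_num)]
      have : (0 : ℝ) ≤ (3 / 4) ^ p.exponentSeq j₀ pass p.N := by positivity
      rw [div_le_iff_of_neg (by norm_num)]
      linarith
    have hbr : p.weightSum pass p.N
        + p.N / p.Llow * ∑ i ∈ Finset.range (p.exponentSeq j₀ pass p.N), (3 / 4 : ℝ) ^ i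
        ≤ 5 * p.N ^ 2 / p.Llow := by
      calc _ ≤ (p.N : ℝ) ^ 2 / (2 * p.Llow) + p.N / p.Llow * 4 :=
            add_le_add (hp.weightSum_le _) (by gcongr)
        _ = ((p.N : ℝ) ^ 2 / 2 + 4 * p.N) / p.Llow := by field_simp
        _ ≤ _ := by
            gcongr
            have hN2 : (2 : ℝ) ≤ p.N := by exact_mod_cast hp.two_le_N
            nlinarith
    have he : (p.exponentSeq j₀ pass p.N : ℝ) ≤ p.m := by exact_mod_cast hp.exponentSeq_le _
    have := mul_le_mul_of_nonneg_left hbr hB.le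
    have e : 5 * p.batchRate * (p.N : ℝ) ^ 2 / p.Llow
        = p.batchRate * (5 * p.N ^ 2 / p.Llow) := by ring
    rw [e]
    linarith

theorem measure_compl_iUnion_badEvent_ge {Ω : Type*} [MeasurableSpace Ω] [MeasurableSpace Ξ]
    {P : Measure Ω} [IsProbabilityMeasure P] {ν : Measure Ξ} {σ : ℝ} {ξ : ℕ → ℕ → ℕ → Ω → Ξ}
    (hζ : ∀ pass : ℕ → ℕ, IsSampleArray P ν fun i : ℕ × ℕ => ξ i.1 (pass i.1) i.2)
    (hG : IsSubGaussianOracle f G ν σ) (hf : HasLipschitzGradient f L) (hp : p.Valid j₀)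
    (hσ : 0 < σ) (hD : 0 ≤ D) (hR : 0 < ‖x₀ - v‖)
    (h1 : 7 * p.logFactor ≤ p.batchRate * p.ε / (64 * σ ^ 2))
    (h2 : ∀ pass, 56 * p.logFactor * D ^ 2 * σ ^ 2 * p.weightSum pass p.N
      ≤ p.batchRate * ‖x₀ - v‖ ^ 4) :
    ENNReal.ofReal (1 - p.α) ≤ P (⋃ c : Fin p.m → Fin (p.N + 1), ⋃ k : Fin p.N,
      badEvent f G p x₀ v D ξ (passCount c) k)ᶜ := by
  set B := ⋃ c : Fin p.m → Fin (p.N + 1), ⋃ k : Fin p.N,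
    badEvent f G p x₀ v D ξ (passCount c) k with hBdef
  set q := Real.exp (1 - 7 * p.logFactor) + Real.exp (-(7 * p.logFactor)) with hq
  have hq0 : 0 ≤ q := by positivity
  have hB : P B ≤ ENNReal.ofReal p.α := by
    calc P B ≤ ∑ c : Fin p.m → Fin (p.N + 1), ∑ k : Fin p.N,
            P (badEvent f G p x₀ v D ξ (passCount c) k) := by
          refine (measure_iUnion_fintype_le _ _).trans (Finset.sum_le_sum fun c _ => ?_)
          exact measure_iUnion_fintype_le _ _
      _ ≤ ∑ c : Fin p.m → Fin (p.N + 1), ∑ k : Fin p.N, ENNReal.ofReal q :=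
          Finset.sum_le_sum fun c _ => Finset.sum_le_sum fun k _ =>
            measure_badEvent_le (hζ _) hG hf hp hσ hD k.2 hR h1 (h2 _)
      _ = ENNReal.ofReal ((p.N + 1 : ℝ) ^ p.m * (p.N * q)) := by
          rw [ENNReal.ofReal_mul (by positivity), ENNReal.ofReal_mul (by positivity),
            ENNReal.ofReal_pow (by positivity), ENNReal.ofReal_natCast,
            ← Nat.cast_succ, ENNReal.ofReal_natCast]
          simp
      _ ≤ _ := ENNReal.ofReal_le_ofReal hp.card_mul_exp_le
  -- Subadditivity alone is used, so `B` need not be shown measurable.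
  have hu : (1 : ENNReal) ≤ P B + P Bᶜ := by
    rw [← measure_univ (μ := P), ← Set.union_compl_self B]
    exact measure_union_le _ _
  rw [ENNReal.ofReal_sub _ hp.α_pos.le, ENNReal.ofReal_one]
  refine tsub_le_iff_left.2 (hu.trans ?_)
  gcongr

end Main

end AccStoch

end

/-! ### Choice of the constants and conclusion. -/

theorem theorem3 :
    ∃ c₁ : ℝ, 0 < c₁ ∧ ∀ c₂ : ℝ, c₁ ≤ c₂ → ∃ b₀ : ℝ, 0 < b₀ ∧ ∀ b : ℝ, b₀ ≤ b →
    ∃ C : ℝ, 0 < C ∧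
    ∀ (n : ℕ) (f : AccStoch.Vec n → ℝ) (L Llow Lbar L₀ ε σ σ₀ α : ℝ) (m j₀ N : ℕ)
      (x₀ xs : AccStoch.Vec n)
      (Ω Ξ : Type*) [MeasurableSpace Ω] [MeasurableSpace Ξ]
      (P : Measure Ω) [IsProbabilityMeasure P] (ν : Measure Ξ)
      (G : AccStoch.Vec n → Ξ → AccStoch.Vec n) (ξ : ℕ → ℕ → ℕ → Ω → Ξ),
      -- the objective, with minimizer `xs`
      ConvexOn ℝ Set.univ f →
      AccStoch.HasLipschitzGradient f L →
      (∀ x, f xs ≤ f x) →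
      -- the constants
      0 < Llow → Llow ≤ L → L ≤ Lbar →
      1 ≤ m → Lbar = 2 ^ m * Llow → j₀ ≤ m → L₀ = 2 ^ j₀ * Llow →
      0 < ε → 0 < σ → σ ≤ σ₀ → 0 < α → α < 1 →
      -- the stochastic oracle
      AccStoch.IsSubGaussianOracle f G ν σ →
      -- the samples: those of the passes that one fixes in advance, one in each iteration, are
      -- i.i.d. with law `ν` (whether or not other passes of the same iteration reuse them)
      (∀ k j l, Measurable (ξ k j l)) →
      (∀ k j l, P.map (ξ k j l) = ν) →
      (∀ pass : ℕ → ℕ, iIndepFun (fun i : ℕ × ℕ => ξ i.1 (pass i.1) i.2) P) →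
      -- the number of iterations is of order `√(Lbar R² / ε)`, with `R = ‖x₀ - xs‖`
      2 ≤ N →
      c₁ * √(Lbar * ‖x₀ - xs‖ ^ 2 / ε) ≤ N →
      N ≤ c₂ * √(Lbar * ‖x₀ - xs‖ ^ 2 / ε) →
      ENNReal.ofReal (1 - α) ≤
        P {ω | ∃ s : AccStoch.State n,
          AccStoch.run f G ⟨Llow, Lbar, L₀, ε, σ₀, α, b, m, N⟩ x₀
            (fun k j l => ξ k j l ω) N = some s ∧
          f s.x - f xs ≤ ε ∧
          (s.calls : ℝ) ≤
            C * (σ₀ ^ 2 * ‖x₀ - xs‖ ^ 2 * Lbar ^ 3 / (ε ^ 2 * Llow ^ 3)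
              * (Real.log α⁻¹ + m * Real.log N)) + N + m} := by
  -- The value `5` makes `25/8 ≥ 3` in `hAlow`. In `b₀`, the product comes from the martingale bound
  -- `h2` and `448 = 7 * 64` from the single-step bound `h1`. In `C`, the `5b` is the cost per `N²`
  -- and `c₂²` bounds `N²`.
  refine ⟨5, by norm_num, fun c₂ hc₂ => ⟨28 * (3 + c₂ ^ 2) * c₂ ^ 2 + 448, by positivity,
    fun b hb => ⟨5 * b * c₂ ^ 2, ?_, ?_⟩⟩⟩
  · have : 0 < b := lt_of_lt_of_le (by positivity) hb
    positivity
  intro n f L Llow Lbar L₀ ε σ σ₀ α m j₀ N x₀ xs Ω Ξ _ _ P _ ν G ξ hconv hf hmin hLlow hLL hLLbar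
    hm hLbar hj₀ hL₀ hε hσ hσσ hα hα1 hG hξ hν hind hN hN1 hN2
  set p : AccStoch.Params := ⟨Llow, Lbar, L₀, ε, σ₀, α, b, m, N⟩ with hpdef
  have hb0 : 0 < b := lt_of_lt_of_le (by positivity) hb
  have hσ₀ : 0 < σ₀ := hσ.trans_le hσσ
  have hLbar0 : 0 < Lbar := hLlow.trans_le (hLL.trans hLLbar)
  have hp : p.Valid j₀ := ⟨hLlow, hm, hLbar, hj₀, hL₀, hε, hσ₀, hα, hα1, hb0, hN⟩
  have hc₂0 : 0 < c₂ := by linarith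
  have hNpos : (2 : ℝ) ≤ N := by exact_mod_cast hN
  set R := ‖x₀ - xs‖ with hRdef
  -- If `R = 0`, the upper bound on `N` would force `N ≤ 0`.
  have hR : 0 < R := by
    rcases (norm_nonneg (x₀ - xs)).eq_or_lt with h0 | h0
    · rw [hRdef, ← h0] at hN2
      simp only [ne_eq, OfNat.ofNat_ne_zero, not_false_eq_true, zero_pow, mul_zero, zero_div,
        Real.sqrt_zero] at hN2
      linarith
    · exact h0
  have hsq : √(Lbar * R ^ 2 / ε) ^ 2 = Lbar * R ^ 2 / ε := Real.sq_sqrt (by positivity)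
  have hNlow : 25 * (Lbar * R ^ 2 / ε) ≤ (N : ℝ) ^ 2 := by
    have := pow_le_pow_left₀ (by positivity) hN1 2
    rw [mul_pow, hsq] at this
    linarith
  have hNup : (N : ℝ) ^ 2 ≤ c₂ ^ 2 * (Lbar * R ^ 2 / ε) := by
    have := pow_le_pow_left₀ (by positivity) hN2 2
    rwa [mul_pow, hsq] at this
  have hAlow : ∀ pass, 3 * R ^ 2 ≤ p.weightSum pass N * ε := fun pass => by
    calc 3 * R ^ 2 ≤ 25 * (Lbar * R ^ 2 / ε) / (8 * Lbar) * ε := by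
          have : 25 * (Lbar * R ^ 2 / ε) / (8 * Lbar) * ε = 25 / 8 * R ^ 2 := by field_simp
          rw [this]
          nlinarith [sq_nonneg R]
      _ ≤ (N : ℝ) ^ 2 / (8 * Lbar) * ε := by gcongr
      _ ≤ _ := by
          gcongr
          exact hp.le_weightSum N
  have hAup : ∀ pass, p.weightSum pass N * ε ≤ c₂ ^ 2 * R ^ 2 * (Lbar / Llow) / 2 := fun pass => by
    calc p.weightSum pass N * ε ≤ (N : ℝ) ^ 2 / (2 * Llow) * ε := by
          gcongr
          exact hp.weightSum_le N
      _ ≤ c₂ ^ 2 * (Lbar * R ^ 2 / ε) / (2 * Llow) * ε := by gcongr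
      _ = _ := by field_simp
  have hratio : 1 ≤ Lbar / Llow := (one_le_div hLlow).2 (hLL.trans hLLbar)
  -- Chosen so that `3R² + A_N ε ≤ D²`. Both `D²` and the bound on `A_N ε` carry a factor `L̄ / L̲`;
  -- their product in `h2` is matched by the factor `L̄² / L̲²` in the batch size.
  set D := √((3 + c₂ ^ 2) * R ^ 2 * (Lbar / Llow)) with hDdef
  have hD : D ^ 2 = (3 + c₂ ^ 2) * R ^ 2 * (Lbar / Llow) := Real.sq_sqrt (by positivity)
  have hl := hp.logFactor_pos
  have hrate : p.batchRate = b * (σ₀ ^ 2 * Lbar ^ 2 / (ε * Llow ^ 2) * p.logFactor) := rfl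
  have hσ2 : σ ^ 2 ≤ σ₀ ^ 2 := by gcongr
  have h1 : 7 * p.logFactor ≤ p.batchRate * ε / (64 * σ ^ 2) := by
    have e : p.batchRate * ε = b * p.logFactor * (σ₀ ^ 2 * (Lbar / Llow) ^ 2) := by
      rw [hrate]
      field_simp
    rw [le_div_iff₀ (by positivity), e]
    have h448 : 448 ≤ b := le_trans (by nlinarith [sq_nonneg c₂, sq_nonneg (c₂ ^ 2)]) hb
    calc 7 * p.logFactor * (64 * σ ^ 2) = 448 * p.logFactor * (σ ^ 2 * 1) := by ring
      _ ≤ b * p.logFactor * (σ₀ ^ 2 * (Lbar / Llow) ^ 2) := by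
          gcongr
          exact one_le_pow₀ hratio
  have h2 : ∀ pass, 56 * p.logFactor * D ^ 2 * σ ^ 2 * p.weightSum pass N
      ≤ p.batchRate * R ^ 4 := fun pass => by
    refine le_of_mul_le_mul_right ?_ hε
    have e : p.batchRate * R ^ 4 * ε = b * p.logFactor * (σ₀ ^ 2 * (Lbar / Llow) ^ 2) * R ^ 4 := by
      rw [hrate]
      field_simp
    rw [e]
    calc _ = 56 * p.logFactor * D ^ 2 * σ ^ 2 * (p.weightSum pass N * ε) := by ring
      _ ≤ 56 * p.logFactor * D ^ 2 * σ₀ ^ 2 * (c₂ ^ 2 * R ^ 2 * (Lbar / Llow) / 2) := by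
          have := hAup pass
          have : 0 ≤ p.weightSum pass N * ε := mul_nonneg (hp.weightSum_nonneg N) hε.le
          gcongr
      _ = (28 * (3 + c₂ ^ 2) * c₂ ^ 2) * (p.logFactor * (σ₀ ^ 2 * (Lbar / Llow) ^ 2) * R ^ 4) := by
          rw [hD]
          ring
      _ ≤ b * (p.logFactor * (σ₀ ^ 2 * (Lbar / Llow) ^ 2) * R ^ 4) := by
          gcongr
          linarith
      _ = _ := by ring
  refine (AccStoch.measure_compl_iUnion_badEvent_ge (p := p) (D := D) (v := xs) (x₀ := x₀)
    (fun pass => ⟨fun i => hξ _ _ _, fun i => hν _ _ _, hind pass⟩) hG hf hp hσ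
    (Real.sqrt_nonneg _) hR h1 h2).trans (measure_mono fun ω hω => ?_)
  obtain ⟨s, hs, hfs, hcalls⟩ := AccStoch.exists_run_eq_some (p := p) (D := D) (v := xs) (x₀ := x₀)
    (G := G) (w := fun k j l => ξ k j l ω) hconv hf hmin hp hLLbar (Real.sqrt_nonneg _)
    (fun pass => by
      rw [hD]
      have hA := hAup pass
      have : 3 * R ^ 2 * 1 ≤ 3 * R ^ 2 * (Lbar / Llow) := by gcongr
      have : 0 ≤ c₂ ^ 2 * R ^ 2 * (Lbar / Llow) := by positivity
      change 3 * R ^ 2 + p.weightSum pass N * ε ≤ _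
      linarith)
    hAlow
    (fun c k hk => by
      have hωk : ω ∉ AccStoch.badEvent f G p x₀ xs D ξ (AccStoch.passCount c) k := fun h =>
        hω (Set.mem_iUnion.2 ⟨c, Set.mem_iUnion.2 ⟨⟨k, hk⟩, h⟩⟩)
      exact ⟨not_lt.1 fun h => hωk (Or.inl h), not_lt.1 fun h => hωk (Or.inr h)⟩)
  refine ⟨s, hs, hfs, hcalls.trans ?_⟩
  have hlog : p.logFactor = Real.log α⁻¹ + m * Real.log N := rfl
  rw [← hlog]
  change 5 * p.batchRate * (N : ℝ) ^ 2 / Llow + N + m ≤ _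
  gcongr
  have hB := hp.batchRate_pos
  calc 5 * p.batchRate * (N : ℝ) ^ 2 / Llow
      ≤ 5 * p.batchRate * (c₂ ^ 2 * (Lbar * R ^ 2 / ε)) / Llow := by gcongr
    _ = _ := by
        rw [hrate]
        field_simp
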